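/- Let $U\subseteq\mathbb C^2$ be open with coordinates $(x,y)$, and let $0\le\Delta\le n$ and $k\ge 0$ be integers. For $m\in\mathbb Z_{\ge0}$ let $\mathcal T_m$ be the span of the monomials $x^iy^j$ with $i,j\ge 0$, $i+j\le m$, and put $n_1=n-\Delta$, $n_2=n$. A scalar differential operator of order at most $k$ is an operator $\sum_{s+t\le k}f_{st}\,\partial_x^s\partial_y^t$ on $C^\infty(U,\mathbb C)$ with coefficients $f_{st}\in C^\infty(U,\mathbb C)$; a $2\times2$ matrix operator has order at most $k$ if all its entries do. The distinguished complement for $\mathcal T_{n-\Delta}\oplus\mathcal T_n$ is the space of all $2\times 2$ matrix differential operators $T=(T_{rc})$ that map $\mathcal T_{n-\Delta}\oplus\mathcal T_n$ into itself and whose entries have the form $T_{rc}=\sum_{s+t\le n_c}f_{st}\,\partial_x^s\partial_y^t$. Let $J^1_m=x^2\partial_x+xy\partial_y-mx$, $J^2_m=xy\partial_x+y^2\partial_y-my$, $J^3_m=y\partial_x$, $J^4_m=\partial_x$, $J^5_m=\partial_y$, $J^6_m=x\partial_y$, $J^7_m=x\partial_x-\frac m3$, $J^8_m=y\partial_y-\frac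 m3$, and $T^i=\operatorname{diag}(J^i_{n-\Delta},J^i_n)$. Let $P_1=\operatorname{diag}(1,0)$, $P_2=\operatorname{diag}(0,1)$, $\sigma^+=\begin{pmatrix}0&1\\0&0\end{pmatrix}$, $\sigma^-=(\sigma^+)^t$, and for $\alpha,\beta\ge0$, $\alpha+\beta\le\Delta$, $$Q^-_{\alpha\beta}=x^\alpha y^\beta\,\sigma^-,\qquad Q^+_{\alpha\beta}=\prod_{l=1}^{\Delta-\alpha-\beta}(x\partial_x+y\partial_y-n+\Delta-l)\,\partial_x^\alpha\partial_y^\beta\,\sigma^+ .$$ For $\epsilon\in\{1,2,+,-\}$, a monomial of type $\epsilon$ is a product $T^K_\epsilon=X_\epsilon\,(T^1)^{k_1}\cdots(T^8)^{k_8}$ with $K\in\mathbb Z_{\ge0}^8$, where $X_1=P_1$, $X_2=P_2$ and $X_\pm$ is one of the $Q^\pm_{\alpha\beta}$; write $|K|=k_1+\dots+k_8$. A matrix operator has bidegree $(a,b)\in\mathbb Z^2$ if each of its entries maps each $x^iy^j$ ($i,j\ge0$) to a multiple of $x^{i+a}y^{j+b}$ (to $0$ if an exponent is negative). The length of $T^K_\epsilon$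 is the minimum of $|L|$ over all monomials $T^L_\epsilon$ of the same type and the same bidegree with $|L|\le|K|$, and $T^K_\epsilon$ is of maximal length if its length is $|K|$. For each $\epsilon$ choose, in any way, a set $S_\epsilon$ consisting of one monomial of type $\epsilon$ of maximal length for each bidegree that occurs. Theorem. Every operator of order at most $k$ in the distinguished complement for $\mathcal T_{n-\Delta}\oplus\mathcal T_n$ is a linear combination, with complex coefficients, of the monomials $$T^L_\epsilon\,(T^7)^i(T^8)^j,\qquad \epsilon=1,2,\pm,\quad T^L_\epsilon\in S_\epsilon,\quad i,j\ge0,\quad i+j+|L|\le k-\delta_{\epsilon+}\Delta .$$ (In particular, no monomial with $\epsilon=+$ occurs if $\Delta>k$.) -/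

import Mathlib

open scoped ContDiff

noncomputable section

namespace TriangularQES

open TopologicalSpace

/-! ### Smooth functions on an open subset of `ℂ²` and scalar differential operators -/

/-- Extension by zero of a function on `U ⊆ ℂ²`; only its values on `U` matter. -/
def ext0 (U : Opens (ℂ × ℂ)) (f : U → ℂ) : ℂ × ℂ → ℂ :=
  open Classical in fun z => if h : z ∈ U then f ⟨z, h⟩ else 0

theorem ext0_of_mem {U : Opens (ℂ × ℂ)} (f : U → ℂ) {z : ℂ × ℂ} (h : z ∈ U) :
    ext0 U f z = f ⟨z, h⟩ := by
  simp [ext0, h]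

/-- The algebra `C^∞(U, ℂ)` of complex-valued functions on `U` that are smooth in the real sense
(holomorphic functions are included). -/
def Smooth (U : Opens (ℂ × ℂ)) : Subalgebra ℂ (U → ℂ) where
  carrier := {f | ContDiffOn ℝ ∞ (ext0 U f) U}
  mul_mem' := by
    intro f g hf hg
    refine (ContDiffOn.mul hf hg).congr ?_
    intro z hz
    simp [ext0_of_mem _ (show z ∈ U from hz)]
  add_mem' := by
    intro f g hf hg
    refine (ContDiffOn.add hf hg).congr ?_
    intro z hz
    simp [ext0_of_mem _ (show z ∈ U from hz)]
  algebraMap_mem' := by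
    intro c
    refine (contDiffOn_const (c := c)).congr ?_
    intro z hz
    simp [ext0_of_mem _ (show z ∈ U from hz)]

theorem smooth_of_contDiffOn {U : Opens (ℂ × ℂ)} {F : ℂ × ℂ → ℂ}
    (hF : ContDiffOn ℝ ∞ F U) : (fun z : U => F z) ∈ Smooth U := by
  refine ContDiffOn.congr hF ?_
  intro z hz
  simp [ext0_of_mem _ (show z ∈ U from hz)]

theorem ext0_differentiableAt {U : Opens (ℂ × ℂ)} (f : Smooth U) {z : ℂ × ℂ} (hz : z ∈ U) :
    DifferentiableAt ℝ (ext0 U f) z :=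
  (ContDiffOn.contDiffAt f.2 (U.isOpen.mem_nhds hz)).differentiableAt (by simp)

theorem ext0_add {U : Opens (ℂ × ℂ)} (f g : U → ℂ) :
    ext0 U (f + g) = ext0 U f + ext0 U g := by
  funext z
  by_cases h : z ∈ U <;> simp [ext0, h]

theorem ext0_smul {U : Opens (ℂ × ℂ)} (c : ℂ) (f : U → ℂ) :
    ext0 U (c • f) = c • ext0 U f := by
  funext z
  by_cases h : z ∈ U <;> simp [ext0, h]

/-- The complex coordinate vector field in the direction `v`, as an operator on `C^∞(U, ℂ)`:
`½ (D_v - i D_{iv})`, where `D` is the real derivative. On holomorphic functions it is the complex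
derivative in the direction `v`. -/
def coordDeriv (U : Opens (ℂ × ℂ)) (v : ℂ × ℂ) : Module.End ℂ (Smooth U) where
  toFun f := ⟨fun z => (1 / 2 : ℂ) *
      (fderiv ℝ (ext0 U f) z v - Complex.I * fderiv ℝ (ext0 U f) z (Complex.I • v)), by
    have h : ContDiffOn ℝ ∞ (fderiv ℝ (ext0 U f)) U :=
      ContDiffOn.fderiv_of_isOpen f.2 U.isOpen (by simp)
    exact smooth_of_contDiffOn
      (F := fun z => (1 / 2 : ℂ) *
        (fderiv ℝ (ext0 U f) z v - Complex.I * fderiv ℝ (ext0 U f) z (Complex.I • v)))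
      (contDiffOn_const.mul ((h.clm_apply contDiffOn_const).sub
        (contDiffOn_const.mul (h.clm_apply contDiffOn_const))))⟩
  map_add' f g := by
    ext z
    have e : fderiv ℝ (ext0 U ((f : U → ℂ) + (g : U → ℂ))) z
        = fderiv ℝ (ext0 U f) z + fderiv ℝ (ext0 U g) z := by
      rw [ext0_add]
      exact fderiv_add (ext0_differentiableAt f z.2) (ext0_differentiableAt g z.2)
    simp only [Subalgebra.coe_add, Pi.add_apply, e, add_apply]
    ring
  map_smul' c f := by
    ext z
    have e : fderiv ℝ (ext0 U (c • (f : U → ℂ))) z = c • fderiv ℝ (ext0 U f) z := by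
      rw [ext0_smul]
      exact fderiv_const_smul (ext0_differentiableAt f z.2) c
    simp only [Subalgebra.coe_smul, Pi.smul_apply, e, smul_apply,
      RingHom.id_apply, smul_eq_mul]
    ring

/-- `∂_x`. -/
def dx (U : Opens (ℂ × ℂ)) : Module.End ℂ (Smooth U) := coordDeriv U (1, 0)

/-- `∂_y`. -/
def dy (U : Opens (ℂ × ℂ)) : Module.End ℂ (Smooth U) := coordDeriv U (0, 1)

/-- The coordinate function `x`. -/
def cx (U : Opens (ℂ × ℂ)) : Smooth U :=
  ⟨fun z => z.1.1, smooth_of_contDiffOn (F := fun z => z.1) contDiff_fst.contDiffOn⟩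

/-- The coordinate function `y`. -/
def cy (U : Opens (ℂ × ℂ)) : Smooth U :=
  ⟨fun z => z.1.2, smooth_of_contDiffOn (F := fun z => z.2) contDiff_snd.contDiffOn⟩

/-- The multiplication operator by a smooth function. -/
def mulOp (U : Opens (ℂ × ℂ)) (f : Smooth U) : Module.End ℂ (Smooth U) := LinearMap.mulLeft ℂ f

/-- `T` is a differential operator of order at most `k`:
`T = ∑_{s + t ≤ k} f_{st} ∂_x^s ∂_y^t` with smooth coefficients `f_{st}`. -/
def HasOrderLE (U : Opens (ℂ × ℂ)) (k : ℕ) (T : Module.End ℂ (Smooth U)) : Prop :=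
  ∃ f : ℕ → ℕ → Smooth U,
    T = ∑ s ∈ Finset.range (k + 1), ∑ t ∈ Finset.range (k + 1 - s),
      mulOp U (f s t) * dx U ^ s * dy U ^ t

/-- The triangular module `𝒯_n`, spanned by the monomials `x^i y^j` with `i + j ≤ n`. -/
def triModule (U : Opens (ℂ × ℂ)) (n : ℕ) : Submodule ℂ (Smooth U) :=
  Submodule.span ℂ {p | ∃ i j : ℕ, i + j ≤ n ∧ p = cx U ^ i * cy U ^ j}

/-- The eight generators `J¹_n, …, J⁸_n` (indexed from `0`) of the realization of `𝔰𝔩₃`. -/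
def genJ (U : Opens (ℂ × ℂ)) (n : ℕ) : Fin 8 → Module.End ℂ (Smooth U) :=
  let X := mulOp U (cx U)
  let Y := mulOp U (cy U)
  ![X ^ 2 * dx U + X * Y * dy U - (n : ℂ) • X,
    X * Y * dx U + Y ^ 2 * dy U - (n : ℂ) • Y,
    Y * dx U,
    dx U,
    dy U,
    X * dy U,
    X * dx U - ((n : ℂ) / 3) • 1,
    Y * dy U - ((n : ℂ) / 3) • 1]

/-- `q̄_{αβ}(n, Δ) = ∏_{k=1}^{Δ-α-β} (x∂_x + y∂_y - n + Δ - k) ∂_x^α ∂_y^β`. -/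
def qBar (U : Opens (ℂ × ℂ)) (n Δ α β : ℕ) : Module.End ℂ (Smooth U) :=
  ((List.range (Δ - α - β)).map fun k =>
    mulOp U (cx U) * dx U + mulOp U (cy U) * dy U
      + (-(n : ℂ) + (Δ : ℂ) - ((k + 1 : ℕ) : ℂ)) • (1 : Module.End ℂ (Smooth U))).prod
    * dx U ^ α * dy U ^ β

/-! ### `2 × 2` matrix operators -/

/-- `2 × 2` matrices of operators on `C^∞(U, ℂ)`; the product is composition. -/
abbrev MatOp (U : Opens (ℂ × ℂ)) := Matrix (Fin 2) (Fin 2) (Module.End ℂ (Smooth U))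

/-- The action of a matrix operator on `C^∞(U, ℂ ⊕ ℂ)`. -/
def act {U : Opens (ℂ × ℂ)} (T : MatOp U) (v : Fin 2 → Smooth U) : Fin 2 → Smooth U :=
  fun r => ∑ c, T r c (v c)

/-- The two degrees `n₁ = n - Δ` and `n₂ = n` (used with `Δ ≤ n`). -/
def compDeg (n Δ : ℕ) : Fin 2 → ℕ := ![n - Δ, n]

/-- `T` leaves `𝒯_{n-Δ} ⊕ 𝒯_n` invariant. -/
def PreservesModule (U : Opens (ℂ × ℂ)) (n Δ : ℕ) (T : MatOp U) : Prop :=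
  ∀ v : Fin 2 → Smooth U, (∀ c, v c ∈ triModule U (compDeg n Δ c)) →
    ∀ r, act T v r ∈ triModule U (compDeg n Δ r)

/-- `T` lies in the distinguished complement, in the algebra of the matrix differential operators
preserving `𝒯_{n₁} ⊕ 𝒯_{n₂}`, to those annihilating it: `T` preserves the module and
`T_{rc} = ∑_{s + t ≤ n_c} f_{st} ∂_x^s ∂_y^t`. -/
def InDistinguishedComplement (U : Opens (ℂ × ℂ)) (n Δ : ℕ) (T : MatOp U) : Prop :=
  PreservesModule U n Δ T ∧ ∀ r c, HasOrderLE U (compDeg n Δ c) (T r c)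

/-- A matrix differential operator of order at most `k`. -/
def MatHasOrderLE (U : Opens (ℂ × ℂ)) (k : ℕ) (T : MatOp U) : Prop :=
  ∀ r c, HasOrderLE U k (T r c)

/-- `T^i = diag(J^i_{n-Δ}, J^i_n)` (indexed from `0`). -/
def genT (U : Opens (ℂ × ℂ)) (n Δ : ℕ) (i : Fin 8) : MatOp U :=
  Matrix.diagonal ![genJ U (n - Δ) i, genJ U n i]

/-- The four values `1, 2, +, -` of the label `ε`. -/
inductive Kind
  | one
  | two
  | plus
  | minus

/-- The data `(α, β, K)` of a monomial `X_ε T^K`; `(α, β)` is `(0, 0)` for `ε = 1, 2`. -/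
structure MonIdx where
  α : ℕ
  β : ℕ
  K : Fin 8 → ℕ

/-- The indices that are allowed for the type `ε`. -/
def MonIdx.Admissible (Δ : ℕ) : Kind → MonIdx → Prop
  | .one, m => m.α = 0 ∧ m.β = 0
  | .two, m => m.α = 0 ∧ m.β = 0
  | .plus, m => m.α + m.β ≤ Δ
  | .minus, m => m.α + m.β ≤ Δ

/-- The degree `|K| = k₁ + ⋯ + k₈`. -/
def MonIdx.degree (m : MonIdx) : ℕ := ∑ i, m.K i

/-- The factor `X_ε`: `X_1 = P_1`, `X_2 = P_2`, `X_+ = Q⁺_{αβ} = q̄_{αβ}(n, Δ) σ⁺`,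
`X_- = Q⁻_{αβ} = x^α y^β σ⁻`. -/
def prefactor (U : Opens (ℂ × ℂ)) (n Δ : ℕ) (ε : Kind) (α β : ℕ) : MatOp U :=
  match ε with
  | .one => !![1, 0; 0, 0]
  | .two => !![0, 0; 0, 1]
  | .plus => !![0, qBar U n Δ α β; 0, 0]
  | .minus => !![0, 0; mulOp U (cx U ^ α * cy U ^ β), 0]

/-- The monomial `T^K_ε = X_ε (T¹)^{k₁} ⋯ (T⁸)^{k₈}`. -/
def monOp (U : Opens (ℂ × ℂ)) (n Δ : ℕ) (ε : Kind) (m : MonIdx) : MatOp U :=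
  prefactor U n Δ ε m.α m.β * (List.ofFn fun i : Fin 8 => genT U n Δ i ^ m.K i).prod

/-- The line spanned by `x^i y^j`, for integer exponents; it is `0` if an exponent is negative. -/
def monomialLine (U : Opens (ℂ × ℂ)) (i j : ℤ) : Submodule ℂ (Smooth U) :=
  Submodule.span ℂ {p | ∃ a b : ℕ, (a : ℤ) = i ∧ (b : ℤ) = j ∧ p = cx U ^ a * cy U ^ b}

/-- `T` has bidegree `d`: every entry of `T` maps `x^i y^j` into the line spanned by
`x^{i + d₁} y^{j + d₂}`. -/
def HasBidegree {U : Opens (ℂ × ℂ)} (T : MatOp U) (d : ℤ × ℤ) : Prop :=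
  ∀ (r c : Fin 2) (i j : ℕ), T r c (cx U ^ i * cy U ^ j) ∈ monomialLine U (i + d.1) (j + d.2)

/-- Two monomials of type `ε` have the same bidegree. -/
def SameBidegree (U : Opens (ℂ × ℂ)) (n Δ : ℕ) (ε : Kind) (m m' : MonIdx) : Prop :=
  ∃ d : ℤ × ℤ, HasBidegree (monOp U n Δ ε m) d ∧ HasBidegree (monOp U n Δ ε m') d

/-- The length of `T^K_ε`: the minimum of `|L|` over the monomials `T^L_ε` of the same type and the
same bidegree with `|L| ≤ |K|`. -/
def monLength (U : Opens (ℂ × ℂ)) (n Δ : ℕ) (ε : Kind) (m : MonIdx) : ℕ :=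
  sInf {l | ∃ m' : MonIdx, m'.Admissible Δ ε ∧ SameBidegree U n Δ ε m' m ∧
    m'.degree ≤ m.degree ∧ l = m'.degree}

/-- `T^K_ε` is a monomial of type `ε` of maximal length: its length is `|K|`. -/
def IsMaximalLength (U : Opens (ℂ × ℂ)) (n Δ : ℕ) (ε : Kind) (m : MonIdx) : Prop :=
  m.Admissible Δ ε ∧ monLength U n Δ ε m = m.degree

/-- `S` consists of monomials of maximal length of type `ε` with different bidegrees, one for each
bidegree that occurs. -/
def IsRepresentativeSystem (U : Opens (ℂ × ℂ)) (n Δ : ℕ) (ε : Kind) (S : Set MonIdx) : Prop :=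
  (∀ m ∈ S, IsMaximalLength U n Δ ε m) ∧
    ∀ m, IsMaximalLength U n Δ ε m → ∃! m', m' ∈ S ∧ SameBidegree U n Δ ε m' m

/-- `Δ` for `ε = +`, and `0` otherwise. -/
def shift (Δ : ℕ) : Kind → ℕ
  | .plus => Δ
  | _ => 0

/-- The monomials `T^L_ε (T⁷)^i (T⁸)^j`, where `ε = 1, 2, ±`, `T^L_ε` runs through the chosen
monomials of maximal length and `i + j + |L| ≤ k - δ_{ε+} Δ` (an inequality of integers). -/
def spanningMonomials (U : Opens (ℂ × ℂ)) (n Δ k : ℕ) (S : Kind → Set MonIdx) : Set (MatOp U) :=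
  {M | ∃ (ε : Kind) (m : MonIdx) (i j : ℕ), m ∈ S ε ∧ i + j + m.degree + shift Δ ε ≤ k ∧
    M = monOp U n Δ ε m * genT U n Δ 6 ^ i * genT U n Δ 7 ^ j}

end TriangularQES

end

open scoped ContDiff

noncomputable section

namespace TriangularQES

open TopologicalSpace

variable {U : Opens (ℂ × ℂ)}

/-! ### Calculus on `C^∞(U, ℂ)` -/

/-! Each entry of `T` is handled separately: it is an operator from `𝒯_m` to `𝒯_{m'}`, where `m` and
`m'` are the degrees of its column and row, and its order is at most `l = min k m`. A finite-order
operator is determined by its values on monomials (`eq_zero_of_apply_mono`), and one that maps `𝒯_m`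
to polynomials has polynomial coefficients when `l ≤ m`, so it splits into finitely many pieces of
fixed bidegree, each again mapping `𝒯_m` to `𝒯_{m'}` (`exists_homogeneous_decomposition`).

A piece of bidegree `(a, b)` is encoded by its symbol, a polynomial `p` of degree at most `l` with
`x^i y^j ↦ p(i, j) x^{i+a} y^{j+b}`. The symbol must vanish at every lattice point whose target is
not allowed: on the lines `i = 0, …, -a - 1` and `j = 0, …, -b - 1`, and at the points of the
antidiagonals `i + j = m - q` with `q < m - m' + a + b`. Since `l ≤ m`, each line carries enough
zeros to force divisibility, so `p` is divisible by a product of `numLines m m' (a, b)` linear forms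
(`symbol_eq_prod_mul`).

Conversely, every bidegree contains a monomial of type `ε` whose order is at most this number of
forms (`exists_short_monomial`), and hence so does every representative system (`exists_short_mem`).
Once some nonzero `p` exists, the symbol of this monomial is a nonzero constant times the same
product, so `p` is that symbol times a polynomial `r` (`exists_eq_mul_of_minimal`). As `T⁷` and `T⁸`
have bidegree zero and symbols `i - m/3` and `j - m/3`, expanding `r` in powers of these two gives
the spanning monomials, with the required bound on the degree (`entry_mem_span`). -/

theorem coordDeriv_apply (v : ℂ × ℂ) (f : Smooth U) (z : U) :
    (coordDeriv U v f : U → ℂ) z = (1 / 2 : ℂ) *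
      (fderiv ℝ (ext0 U f) z v - Complex.I * fderiv ℝ (ext0 U f) z (Complex.I • v)) := rfl

theorem ext0_eventuallyEq {F : ℂ × ℂ → ℂ} {f : U → ℂ} (h : ∀ z : U, f z = F z) (z : U) :
    ext0 U f =ᶠ[nhds (z : ℂ × ℂ)] F := by
  filter_upwards [U.isOpen.mem_nhds z.2] with w hw
  rw [ext0_of_mem f hw, h]

theorem ext0_mul (f g : U → ℂ) : ext0 U (f * g) = ext0 U f * ext0 U g := by
  funext z
  by_cases h : z ∈ U <;> simp [ext0, h]

theorem coordDeriv_mul (v : ℂ × ℂ) (f g : Smooth U) :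
    coordDeriv U v (f * g) = coordDeriv U v f * g + f * coordDeriv U v g := by
  ext z
  have e : fderiv ℝ (ext0 U ((f : U → ℂ) * (g : U → ℂ))) z
      = ext0 U f z • fderiv ℝ (ext0 U g) z + ext0 U g z • fderiv ℝ (ext0 U f) z := by
    rw [ext0_mul]
    exact fderiv_mul (ext0_differentiableAt f z.2) (ext0_differentiableAt g z.2)
  have hf : ext0 U f z = (f : U → ℂ) z := ext0_of_mem _ z.2
  have hg : ext0 U g z = (g : U → ℂ) z := ext0_of_mem _ z.2
  simp only [coordDeriv_apply, Subalgebra.coe_mul, Subalgebra.coe_add, Pi.add_apply,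
    Pi.mul_apply, e, hf, hg, add_apply, smul_apply, smul_eq_mul]
  ring

/-- Complex linearity gives `φ(iv) = i φ(v)`, so both terms of the Wirtinger derivative contribute
`φ(v)/2`. -/
theorem coordDeriv_clm (v : ℂ × ℂ) (f : Smooth U) (φ : (ℂ × ℂ) →L[ℂ] ℂ)
    (h : ∀ z : U, (f : U → ℂ) z = φ z) (z : U) : (coordDeriv U v f : U → ℂ) z = φ v := by
  have e : fderiv ℝ (ext0 U f) z = φ.restrictScalars ℝ := by
    rw [(ext0_eventuallyEq (F := φ.restrictScalars ℝ) h z).fderiv_eq]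
    exact ContinuousLinearMap.fderiv _
  rw [coordDeriv_apply, e]
  simp only [ContinuousLinearMap.coe_restrictScalars', map_smul, smul_eq_mul]
  linear_combination (-φ v / 2) * Complex.I_mul_I

theorem dx_cx : dx U (cx U) = 1 := by
  ext z
  exact coordDeriv_clm (1, 0) (cx U) (ContinuousLinearMap.fst ℂ ℂ ℂ) (fun _ => rfl) z

theorem dx_cy : dx U (cy U) = 0 := by
  ext z
  exact coordDeriv_clm (1, 0) (cy U) (ContinuousLinearMap.snd ℂ ℂ ℂ) (fun _ => rfl) z

theorem dy_cx : dy U (cx U) = 0 := by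
  ext z
  exact coordDeriv_clm (0, 1) (cx U) (ContinuousLinearMap.fst ℂ ℂ ℂ) (fun _ => rfl) z

theorem dy_cy : dy U (cy U) = 1 := by
  ext z
  exact coordDeriv_clm (0, 1) (cy U) (ContinuousLinearMap.snd ℂ ℂ ℂ) (fun _ => rfl) z

theorem dx_mul (f g : Smooth U) : dx U (f * g) = dx U f * g + f * dx U g :=
  coordDeriv_mul _ f g

theorem dy_mul (f g : Smooth U) : dy U (f * g) = dy U f * g + f * dy U g :=
  coordDeriv_mul _ f g

theorem fderiv_ext0_coordDeriv (v w : ℂ × ℂ) (f : Smooth U) (z : U) :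
    fderiv ℝ (ext0 U (coordDeriv U v f)) z w = (1 / 2 : ℂ) *
      (fderiv ℝ (fderiv ℝ (ext0 U f)) z w v
        - Complex.I * fderiv ℝ (fderiv ℝ (ext0 U f)) z w (Complex.I • v)) := by
  have hf : DifferentiableAt ℝ (fderiv ℝ (ext0 U f)) z := by
    have h : ContDiffOn ℝ ∞ (fderiv ℝ (ext0 U f)) U :=
      ContDiffOn.fderiv_of_isOpen f.2 U.isOpen (by simp)
    exact (h.contDiffAt (U.isOpen.mem_nhds z.2)).differentiableAt (by simp)
  have h1 : ∀ u : ℂ × ℂ, HasFDerivAt (fun y => fderiv ℝ (ext0 U f) y u)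
      ((fderiv ℝ (fderiv ℝ (ext0 U f)) z).flip u) z := by
    intro u
    have := hf.hasFDerivAt.clm_apply (hasFDerivAt_const u (z : ℂ × ℂ))
    exact this.congr_fderiv (by rw [ContinuousLinearMap.comp_zero, zero_add])
  have h2 := (((h1 v).sub ((h1 (Complex.I • v)).const_mul Complex.I)).const_mul (1 / 2 : ℂ))
  rw [(ext0_eventuallyEq (F := fun y => (1 / 2 : ℂ) * (fderiv ℝ (ext0 U f) y v
    - Complex.I * fderiv ℝ (ext0 U f) y (Complex.I • v))) (coordDeriv_apply v f) z).fderiv_eq]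
  have h3 := h2.fderiv
  refine (congrArg (fun L => L w) h3).trans ?_
  simp

/-- Both sides are the same combination of second real derivatives, by their symmetry. -/
theorem coordDeriv_comm (v w : ℂ × ℂ) (f : Smooth U) :
    coordDeriv U v (coordDeriv U w f) = coordDeriv U w (coordDeriv U v f) := by
  ext z
  have hs : IsSymmSndFDerivAt ℝ (ext0 U f) z :=
    (f.2.contDiffAt (U.isOpen.mem_nhds z.2)).isSymmSndFDerivAt (by
      rw [minSmoothness_of_isRCLikeNormedField]; exact WithTop.coe_le_coe.2 (le_top : (2 : ℕ∞) ≤ ⊤))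
  rw [coordDeriv_apply, coordDeriv_apply]
  simp only [fderiv_ext0_coordDeriv]
  rw [hs.eq v w, hs.eq v (Complex.I • w), hs.eq (Complex.I • v) w,
    hs.eq (Complex.I • v) (Complex.I • w)]
  ring

theorem dx_dy_comm : Commute (dx U) (dy U) :=
  LinearMap.ext fun f => coordDeriv_comm (1, 0) (0, 1) f

/-- The monomial `x^i y^j` as a smooth function. -/
def mono (U : Opens (ℂ × ℂ)) (i j : ℕ) : Smooth U := cx U ^ i * cy U ^ j

theorem dx_one : dx U 1 = 0 := by
  have h := dx_mul (U := U) 1 1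
  simpa using h

theorem dy_one : dy U 1 = 0 := by
  have h := dy_mul (U := U) 1 1
  simpa using h

theorem dx_mono (i j : ℕ) : dx U (mono U i j) = (i : ℂ) • mono U (i - 1) j := by
  have hy : ∀ j : ℕ, dx U (cy U ^ j) = 0 := by
    intro j
    induction j with
    | zero => simpa using dx_one
    | succ j ih => rw [pow_succ, dx_mul, ih, dx_cy]; simp
  have hx : ∀ i : ℕ, dx U (cx U ^ i) = (i : ℂ) • cx U ^ (i - 1) := by
    intro i
    induction i with
    | zero => simpa using dx_one
    | succ i ih =>
      rw [pow_succ, dx_mul, ih, dx_cx]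
      rcases i with _ | i
      · simp
      · simp only [Nat.add_sub_cancel, smul_mul_assoc, ← pow_succ, mul_one]
        push_cast
        module
  rw [mono, dx_mul, hx, hy, mono]
  simp

theorem dy_mono (i j : ℕ) : dy U (mono U i j) = (j : ℂ) • mono U i (j - 1) := by
  have hx : ∀ j : ℕ, dy U (cx U ^ j) = 0 := by
    intro j
    induction j with
    | zero => simpa using dy_one
    | succ j ih => rw [pow_succ, dy_mul, ih, dy_cx]; simp
  have hy : ∀ i : ℕ, dy U (cy U ^ i) = (i : ℂ) • cy U ^ (i - 1) := by
    intro i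
    induction i with
    | zero => simpa using dy_one
    | succ i ih =>
      rw [pow_succ, dy_mul, ih, dy_cy]
      rcases i with _ | i
      · simp
      · simp only [Nat.add_sub_cancel, smul_mul_assoc, ← pow_succ, mul_one]
        push_cast
        module
  rw [mono, dy_mul, hx, hy, mono]
  simp

theorem dx_pow_mono (s i j : ℕ) :
    (dx U ^ s) (mono U i j) = (i.descFactorial s : ℂ) • mono U (i - s) j := by
  induction s with
  | zero => simp
  | succ s ih =>
    rw [pow_succ', Module.End.mul_apply, ih, map_smul, dx_mono, Nat.descFactorial_succ, smul_smul,
      Nat.sub_sub]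
    push_cast
    ring_nf

theorem dy_pow_mono (s i j : ℕ) :
    (dy U ^ s) (mono U i j) = (j.descFactorial s : ℂ) • mono U i (j - s) := by
  induction s with
  | zero => simp
  | succ s ih =>
    rw [pow_succ', Module.End.mul_apply, ih, map_smul, dy_mono, Nat.descFactorial_succ, smul_smul,
      Nat.sub_sub]
    push_cast
    ring_nf

theorem mulOp_apply (f g : Smooth U) : mulOp U f g = f * g := rfl

theorem mono_mul (i j a b : ℕ) : mono U i j * mono U a b = mono U (i + a) (j + b) := by
  simp only [mono, pow_add]; ring

/-- The truncated exponents do no harm: `descFactorial` vanishes as soon as `s > i` or `t > j`. -/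
theorem diffMonomial_apply_mono (f : Smooth U) (s t i j : ℕ) :
    (mulOp U f * dx U ^ s * dy U ^ t) (mono U i j)
      = ((i.descFactorial s * j.descFactorial t : ℕ) : ℂ) • (f * mono U (i - s) (j - t)) := by
  rw [Module.End.mul_apply, Module.End.mul_apply, dy_pow_mono, map_smul, dx_pow_mono, mulOp_apply,
    smul_smul, mul_smul_comm]
  push_cast
  ring_nf

/-! ### The order filtration -/

theorem mulOp_add (f g : Smooth U) : mulOp U (f + g) = mulOp U f + mulOp U g := by
  ext; simp [mulOp, add_mul]

theorem mulOp_smul (c : ℂ) (f : Smooth U) : mulOp U (c • f) = c • mulOp U f := by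
  ext; simp [mulOp]

theorem mulOp_zero : mulOp U 0 = 0 := by
  ext; simp [mulOp]

theorem mulOp_one : mulOp U 1 = 1 := by
  ext; simp [mulOp]

theorem mulOp_mul (f g : Smooth U) : mulOp U (f * g) = mulOp U f * mulOp U g := by
  ext; simp [mulOp]

theorem mulOp_pow (f : Smooth U) (n : ℕ) : mulOp U (f ^ n) = mulOp U f ^ n := by
  induction n with
  | zero => simp [mulOp_one]
  | succ n ih => rw [pow_succ, pow_succ, mulOp_mul, ih]

/-- The operators of order at most `k`, as a subspace. -/
def ordSub (U : Opens (ℂ × ℂ)) (k : ℕ) : Submodule ℂ (Module.End ℂ (Smooth U)) where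
  carrier := {T | HasOrderLE U k T}
  add_mem' := by
    rintro _ _ ⟨f, rfl⟩ ⟨g, rfl⟩
    refine ⟨f + g, ?_⟩
    simp only [← Finset.sum_add_distrib, Pi.add_apply, mulOp_add, add_mul]
  zero_mem' := ⟨0, by simp [mulOp_zero]⟩
  smul_mem' := by
    rintro c _ ⟨f, rfl⟩
    refine ⟨c • f, ?_⟩
    simp only [Finset.smul_sum, Pi.smul_apply, mulOp_smul, smul_mul_assoc]

theorem diffMonomial_mem_ordSub {k s t : ℕ} (h : s + t ≤ k) (f : Smooth U) :
    mulOp U f * dx U ^ s * dy U ^ t ∈ ordSub U k := by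
  refine ⟨fun a b => if a = s ∧ b = t then f else 0, ?_⟩
  rw [Finset.sum_eq_single s, Finset.sum_eq_single t]
  · simp
  · intro b _ hb
    simp [hb, mulOp_zero]
  · intro h'
    simp at h'
    omega
  · intro b _ hb
    simp [hb, mulOp_zero]
  · intro h'
    simp at h'
    omega

theorem ordSub_induction {k : ℕ} {M : Submodule ℂ (Module.End ℂ (Smooth U))}
    {φ : Module.End ℂ (Smooth U) →ₗ[ℂ] Module.End ℂ (Smooth U)}
    (h : ∀ (f : Smooth U) (s t : ℕ), s + t ≤ k → φ (mulOp U f * dx U ^ s * dy U ^ t) ∈ M)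
    {T : Module.End ℂ (Smooth U)} (hT : T ∈ ordSub U k) : φ T ∈ M := by
  obtain ⟨f, rfl⟩ := hT
  rw [map_sum]
  refine Submodule.sum_mem _ fun s hs => ?_
  rw [map_sum]
  refine Submodule.sum_mem _ fun t ht => h _ _ _ ?_
  simp at hs ht
  omega

theorem ordSub_mono {k l : ℕ} (h : k ≤ l) : ordSub U k ≤ ordSub U l := fun _ hT =>
  ordSub_induction (U := U) (φ := LinearMap.id) (M := ordSub U l) (fun f _ _ hst => diffMonomial_mem_ordSub (hst.trans h) f) hT

theorem mulOp_mul_mem_ordSub {k : ℕ} (g : Smooth U) {T : Module.End ℂ (Smooth U)}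
    (hT : T ∈ ordSub U k) : mulOp U g * T ∈ ordSub U k := by
  refine ordSub_induction (U := U) (φ := LinearMap.mulLeft ℂ (mulOp U g)) (fun f s t hst => ?_) hT
  rw [LinearMap.mulLeft_apply, ← mul_assoc, ← mul_assoc, ← mulOp_mul]
  exact diffMonomial_mem_ordSub hst _

theorem dx_mul_mulOp (f : Smooth U) : dx U * mulOp U f = mulOp U f * dx U + mulOp U (dx U f) := by
  ext1 g
  simp only [Module.End.mul_apply, LinearMap.add_apply, mulOp_apply, dx_mul]
  ring

theorem dy_mul_mulOp (f : Smooth U) : dy U * mulOp U f = mulOp U f * dy U + mulOp U (dy U f) := by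
  ext1 g
  simp only [Module.End.mul_apply, LinearMap.add_apply, mulOp_apply, dy_mul]
  ring

theorem dx_mul_mem_ordSub {k : ℕ} {T : Module.End ℂ (Smooth U)}
    (hT : T ∈ ordSub U k) : dx U * T ∈ ordSub U (k + 1) := by
  refine ordSub_induction (U := U) (φ := LinearMap.mulLeft ℂ (dx U)) (fun f s t hst => ?_) hT
  rw [LinearMap.mulLeft_apply, ← mul_assoc, ← mul_assoc, dx_mul_mulOp, add_mul, add_mul,
    mul_assoc (mulOp U f), ← pow_succ']
  exact add_mem (diffMonomial_mem_ordSub (by omega) _) (diffMonomial_mem_ordSub (by omega) _)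

theorem dy_mul_mem_ordSub {k : ℕ} {T : Module.End ℂ (Smooth U)}
    (hT : T ∈ ordSub U k) : dy U * T ∈ ordSub U (k + 1) := by
  refine ordSub_induction (U := U) (φ := LinearMap.mulLeft ℂ (dy U)) (fun f s t hst => ?_) hT
  rw [LinearMap.mulLeft_apply, ← mul_assoc, ← mul_assoc, dy_mul_mulOp, add_mul, add_mul,
    mul_assoc (mulOp U f), ← (dx_dy_comm.pow_left s).eq, ← mul_assoc, mul_assoc _ (dy U),
    ← pow_succ']
  exact add_mem (diffMonomial_mem_ordSub (by omega) _) (diffMonomial_mem_ordSub (by omega) _)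

/-- The left factor is reduced to a single `f ∂_x^s ∂_y^t`, whose derivatives are moved past `T'`
one at a time by the Leibniz rule. -/
theorem mul_mem_ordSub {k l : ℕ} {T T' : Module.End ℂ (Smooth U)}
    (hT : T ∈ ordSub U k) (hT' : T' ∈ ordSub U l) : T * T' ∈ ordSub U (k + l) := by
  refine ordSub_induction (U := U) (φ := LinearMap.mulRight ℂ T') (fun f s t hst => ?_) hT
  have hy : dy U ^ t * T' ∈ ordSub U (l + t) := by
    clear hst
    induction t with
    | zero => simpa using hT'
    | succ t ih => rw [pow_succ', mul_assoc]; exact dy_mul_mem_ordSub ih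
  have hx : dx U ^ s * (dy U ^ t * T') ∈ ordSub U (l + t + s) := by
    clear hst
    induction s with
    | zero => simpa using hy
    | succ s ih => rw [pow_succ', mul_assoc]; exact dx_mul_mem_ordSub ih
  rw [LinearMap.mulRight_apply, mul_assoc, mul_assoc]
  exact ordSub_mono (by omega) (mulOp_mul_mem_ordSub f hx)

theorem mulOp_mem_ordSub (f : Smooth U) : mulOp U f ∈ ordSub U 0 := by
  simpa using diffMonomial_mem_ordSub (s := 0) (t := 0) le_rfl f

theorem one_mem_ordSub : (1 : Module.End ℂ (Smooth U)) ∈ ordSub U 0 := by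
  simpa [mulOp_one] using mulOp_mem_ordSub (1 : Smooth U)

theorem dx_mem_ordSub : dx U ∈ ordSub U 1 := by
  simpa using dx_mul_mem_ordSub (one_mem_ordSub (U := U))

theorem dy_mem_ordSub : dy U ∈ ordSub U 1 := by
  simpa using dy_mul_mem_ordSub (one_mem_ordSub (U := U))

/-! ### Recovering the coefficients from the values on monomials -/

/-- Triangularity: the value at `x^i y^j` is `i! j! f_{ij}` plus multiples of `f_{st}` with `s ≤ i`,
`t ≤ j` and `s + t < i + j`, times monomials. `N = ⊥` yields uniqueness of the operator, `N =
polySpan U` polynomial coefficients. -/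
theorem coeff_mem_of_apply_mono_mem {N : Submodule ℂ (Smooth U)}
    (hN : ∀ (i j : ℕ), ∀ f ∈ N, f * mono U i j ∈ N) {k : ℕ} {f : ℕ → ℕ → Smooth U}
    (h : ∀ i j : ℕ, i + j ≤ k → (∑ s ∈ Finset.range (k + 1), ∑ t ∈ Finset.range (k + 1 - s),
      mulOp U (f s t) * dx U ^ s * dy U ^ t) (mono U i j) ∈ N) :
    ∀ i j : ℕ, i + j ≤ k → f i j ∈ N := by
  suffices H : ∀ m i j : ℕ, i + j = m → m ≤ k → f i j ∈ N from
    fun i j hij => H _ i j rfl hij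
  intro m
  induction m using Nat.strong_induction_on with
  | _ m ih =>
    intro i j hij hm
    have h1 := h i j (by omega)
    rw [Finset.sum_sigma', LinearMap.sum_apply] at h1
    rw [← Finset.add_sum_erase _ _ (a := (⟨i, j⟩ : (_ : ℕ) × ℕ)) (by simp; omega)] at h1
    have h2 := (Submodule.add_mem_iff_left N (Submodule.sum_mem _ ?_)).1 h1
    · simp only [diffMonomial_apply_mono, Nat.sub_self, Nat.descFactorial_self] at h2
      have h3 : mono U 0 0 = 1 := by simp [mono]
      rw [h3, mul_one] at h2
      exact (Submodule.smul_mem_iff _ (Nat.cast_ne_zero.2 (by positivity))).1 h2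
    · rintro ⟨s, t⟩ hst
      simp only [Finset.mem_erase, Finset.mem_sigma, Finset.mem_range, ne_eq, Sigma.mk.injEq,
        heq_eq_eq] at hst
      simp only [diffMonomial_apply_mono]
      by_cases hs : i < s
      · simp [Nat.descFactorial_of_lt hs]
      by_cases ht : j < t
      · simp [Nat.descFactorial_of_lt ht]
      exact Submodule.smul_mem _ _ (hN _ _ _ (ih (s + t) (by omega) s t rfl (by omega)))

theorem eq_zero_of_apply_mono {k : ℕ} {T : Module.End ℂ (Smooth U)} (hT : T ∈ ordSub U k)
    (h : ∀ i j : ℕ, T (mono U i j) = 0) : T = 0 := by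
  obtain ⟨f, rfl⟩ := hT
  have h1 := coeff_mem_of_apply_mono_mem (N := ⊥) (k := k) (f := f) (by simp)
    (fun i j _ => (Submodule.mem_bot ℂ).2 (h i j))
  refine Finset.sum_eq_zero fun s hs => Finset.sum_eq_zero fun t ht => ?_
  simp at hs ht
  rw [(Submodule.mem_bot ℂ).1 (h1 s t (by omega)), mulOp_zero, zero_mul, zero_mul]

/-! ### Linear independence of the monomials -/

theorem mono_ne_zero [Nonempty U] (i j : ℕ) : mono U i j ≠ 0 := by
  intro h0
  have h := diffMonomial_apply_mono (1 : Smooth U) i j i j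
  rw [h0, map_zero] at h
  simp only [Nat.sub_self, Nat.descFactorial_self, mono, pow_zero, mul_one] at h
  have h1 : (1 : Smooth U) ≠ 0 := one_ne_zero
  exact smul_ne_zero (Nat.cast_ne_zero.2 (by positivity)) h1 h.symm

/-- The monomials are eigenvectors of `x∂_x + i y∂_y`, and the eigenvalues `a + i b` with `a, b`
natural numbers are pairwise different. -/
theorem linearIndependent_mono [Nonempty U] :
    LinearIndependent ℂ (fun e : ℕ × ℕ => mono U e.1 e.2) := by
  refine Module.End.eigenvectors_linearIndependent'
    (mulOp U (cx U) * dx U + Complex.I • (mulOp U (cy U) * dy U))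
    (fun e : ℕ × ℕ => (e.1 : ℂ) + Complex.I * e.2) ?_ _ (fun e => ⟨?_, mono_ne_zero _ _⟩)
  · rintro ⟨a, b⟩ ⟨c, d⟩ h
    have h1 := congrArg Complex.re h
    have h2 := congrArg Complex.im h
    simp at h1 h2
    simp [h1, h2]
  · obtain ⟨i, j⟩ := e
    rw [Module.End.mem_eigenspace_iff]
    simp only [LinearMap.add_apply, LinearMap.smul_apply, Module.End.mul_apply, dx_mono, dy_mono,
      map_smul, mulOp_apply]
    have hx : (i : ℂ) • (cx U * mono U (i - 1) j) = (i : ℂ) • mono U i j := by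
      rcases i with _ | i
      · simp
      · rw [Nat.add_sub_cancel, mono, mono, pow_succ']; ring_nf
    have hy : (j : ℂ) • (cy U * mono U i (j - 1)) = (j : ℂ) • mono U i j := by
      rcases j with _ | j
      · simp
      · rw [Nat.add_sub_cancel, mono, mono, pow_succ']; ring_nf
    rw [hx, hy]
    module

/-- Coefficient extraction, continued linearly to all smooth functions; its values off the
polynomials are arbitrary. -/
theorem exists_coeff [Nonempty U] : ∃ φ : Smooth U →ₗ[ℂ] (ℕ × ℕ →₀ ℂ),
    ∀ i j, φ (mono U i j) = Finsupp.single (i, j) 1 := by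
  obtain ⟨φ, hφ⟩ := LinearMap.exists_leftInverse_of_injective
    (Finsupp.linearCombination ℂ (fun e : ℕ × ℕ => mono U e.1 e.2))
    (LinearMap.ker_eq_bot.2 linearIndependent_mono)
  refine ⟨φ, fun i j => ?_⟩
  have := LinearMap.congr_fun hφ (Finsupp.single (i, j) 1)
  simpa using this

/-! ### Polynomial functions in two variables and division by lines -/

/-- The affine functions on `ℂ²`. -/
def affineFun : Submodule ℂ (ℂ × ℂ → ℂ) := Submodule.span ℂ {1, Prod.fst, Prod.snd}

/-- The polynomial functions of degree less than `k` on `ℂ²`. -/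
def polyLT : ℕ → Submodule ℂ (ℂ × ℂ → ℂ)
  | 0 => ⊥
  | k + 1 => affineFun ^ k

theorem polyLT_succ (k : ℕ) : polyLT (k + 1) = affineFun ^ k := rfl

theorem mem_affineFun_iff {l : ℂ × ℂ → ℂ} :
    l ∈ affineFun ↔ ∃ a b c : ℂ, l = fun z => a + b * z.1 + c * z.2 := by
  constructor
  · intro h
    obtain ⟨a, b, c, rfl⟩ := Submodule.mem_span_triple.1 h
    exact ⟨a, b, c, by ext z; simp⟩
  · rintro ⟨a, b, c, rfl⟩
    exact Submodule.mem_span_triple.2 ⟨a, b, c, by ext z; simp⟩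

theorem one_le_affineFun : (1 : Submodule ℂ (ℂ × ℂ → ℂ)) ≤ affineFun :=
  Submodule.one_le.2 (Submodule.subset_span (by simp))

theorem affineFun_pow_mono {k l : ℕ} (h : k ≤ l) : affineFun ^ k ≤ affineFun ^ l :=
  pow_le_pow_right₀ one_le_affineFun h

theorem polyLT_mono {k l : ℕ} (h : k ≤ l) : polyLT k ≤ polyLT l := by
  rcases k with _ | k
  · exact bot_le
  rcases l with _ | l
  · omega
  exact affineFun_pow_mono (by omega)

/-- Composition with a map of `ℂ²`. -/
def compMap (φ : ℂ × ℂ → ℂ × ℂ) : (ℂ × ℂ → ℂ) →ₐ[ℂ] (ℂ × ℂ → ℂ) where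
  toFun p := p ∘ φ
  map_one' := rfl
  map_mul' _ _ := rfl
  map_zero' := rfl
  map_add' _ _ := rfl
  commutes' _ := rfl

/-- Composition with `φ` is an algebra map that sends `affineFun` into itself, hence also its
powers. -/
theorem comp_mem_affineFun_pow {φ : ℂ × ℂ → ℂ × ℂ} (h1 : (fun z => (φ z).1) ∈ affineFun)
    (h2 : (fun z => (φ z).2) ∈ affineFun) {k : ℕ} {p : ℂ × ℂ → ℂ} (hp : p ∈ affineFun ^ k) :
    p ∘ φ ∈ affineFun ^ k := by
  have h : Submodule.map (compMap φ).toLinearMap affineFun ≤ affineFun := by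
    rw [affineFun, Submodule.map_span_le]
    rintro m (rfl | rfl | rfl)
    · exact Submodule.subset_span (Or.inl rfl)
    · exact h1
    · exact h2
  have h3 := pow_le_pow_left' h k
  rw [← Submodule.map_pow] at h3
  exact h3 ⟨p, hp, rfl⟩

theorem comp_mem_polyLT {φ : ℂ × ℂ → ℂ × ℂ} (h1 : (fun z => (φ z).1) ∈ affineFun)
    (h2 : (fun z => (φ z).2) ∈ affineFun) {k : ℕ} {p : ℂ × ℂ → ℂ} (hp : p ∈ polyLT k) :
    p ∘ φ ∈ polyLT k := by
  rcases k with _ | k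
  · obtain rfl := (Submodule.mem_bot ℂ).1 hp
    exact (Submodule.mem_bot ℂ).2 rfl
  · exact comp_mem_affineFun_pow h1 h2 hp

theorem eval_snd_mem {a : Polynomial ℂ} {k : ℕ} (ha : a.natDegree ≤ k) :
    (fun z : ℂ × ℂ => a.eval z.2) ∈ affineFun ^ k := by
  have h : (fun z : ℂ × ℂ => a.eval z.2)
      = ∑ i ∈ Finset.range (k + 1), a.coeff i • (Prod.snd : ℂ × ℂ → ℂ) ^ i := by
    ext z
    rw [Polynomial.eval_eq_sum_range' (Nat.lt_succ_of_le ha)]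
    simp
  rw [h]
  refine Submodule.sum_mem _ fun i hi => Submodule.smul_mem _ _ ?_
  exact affineFun_pow_mono (by simpa [Nat.lt_succ_iff] using hi)
    (Submodule.pow_mem_pow _ (Submodule.subset_span (by simp)) i)

/-- Division with remainder by `z.1 - c`, by induction on the degree: an affine factor is itself an
affine function of `z.2` plus a multiple of `z.1 - c`. -/
theorem exists_divide_line (c : ℂ) {k : ℕ} {p : ℂ × ℂ → ℂ} (hp : p ∈ affineFun ^ k) :
    ∃ a : Polynomial ℂ, a.natDegree ≤ k ∧ ∃ q ∈ polyLT k,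
      ∀ z, p z = a.eval z.2 + (z.1 - c) * q z := by
  induction k generalizing p with
  | zero =>
    rw [pow_zero, Submodule.mem_one] at hp
    obtain ⟨x, rfl⟩ := hp
    exact ⟨Polynomial.C x, by simp, 0, zero_mem _, fun z => by simp⟩
  | succ k ih =>
    rw [pow_succ] at hp
    refine Submodule.mul_induction_on hp ?_ ?_
    · intro p hp l hl
      obtain ⟨a, ha, q, hq, e⟩ := ih hp
      have hl' := hl
      obtain ⟨x, y, w, rfl⟩ := mem_affineFun_iff.1 hl
      refine ⟨a * (Polynomial.C (x + y * c) + Polynomial.C w * Polynomial.X), ?_,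
        y • (fun z : ℂ × ℂ => a.eval z.2) + q * (fun z => x + y * z.1 + w * z.2), ?_, ?_⟩
      · refine Polynomial.natDegree_mul_le.trans (add_le_add ha ?_)
        compute_degree
      · refine add_mem (Submodule.smul_mem _ _ (eval_snd_mem ha)) ?_
        rcases k with _ | k
        · rw [(Submodule.mem_bot ℂ).1 hq, zero_mul]
          exact zero_mem _
        · rw [polyLT_succ, pow_succ]
          exact Submodule.mul_mem_mul hq hl'
      · intro z
        simp only [Pi.mul_apply, e, Polynomial.eval_mul, Polynomial.eval_add, Polynomial.eval_C,
          Polynomial.eval_X, Pi.add_apply, Pi.smul_apply, smul_eq_mul]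
        ring
    · rintro p p' ⟨a, ha, q, hq, e⟩ ⟨a', ha', q', hq', e'⟩
      refine ⟨a + a', Polynomial.natDegree_add_le_of_degree_le ha ha', q + q', add_mem hq hq', ?_⟩
      intro z
      simp only [Pi.add_apply, e, e', Polynomial.eval_add]
      ring

/-- A polynomial function of degree less than `κ` with at least `κ` zeros on the zero set of `l`
is divisible by `l`. -/
def Divides (l : ℂ × ℂ → ℂ) : Prop :=
  ∀ (κ : ℕ) (p : ℂ × ℂ → ℂ), p ∈ polyLT κ →
    (∃ A : Finset (ℂ × ℂ), κ ≤ A.card ∧ ∀ z ∈ A, l z = 0 ∧ p z = 0) →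
    ∃ r ∈ polyLT (κ - 1), p = l * r

/-- On the line, `p` equals the remainder, a polynomial in `z.2` of degree less than `κ`. Points of
the line differ in `z.2`, so the remainder has `κ` roots and is zero. -/
theorem divides_fst_sub (c : ℂ) : Divides (fun z => z.1 - c) := by
  rintro κ p hp ⟨A, hA, hz⟩
  rcases κ with _ | k
  · exact ⟨0, zero_mem _, by rw [(Submodule.mem_bot ℂ).1 hp, mul_zero]⟩
  obtain ⟨a, ha, q, hq, e⟩ := exists_divide_line c hp
  have hinj : Set.InjOn Prod.snd (A : Set (ℂ × ℂ)) := by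
    intro z hz1 w hw1 h
    exact Prod.ext ((sub_eq_zero.1 (hz z hz1).1).trans (sub_eq_zero.1 (hz w hw1).1).symm) h
  have h0 : a = 0 := by
    refine Polynomial.eq_zero_of_natDegree_lt_card_of_eval_eq_zero' a (A.image Prod.snd) ?_ ?_
    · intro v hv
      obtain ⟨z, hzA, rfl⟩ := Finset.mem_image.1 hv
      have h1 := e z
      have h2 : z.1 - c = 0 := (hz z hzA).1
      rw [(hz z hzA).2, h2, zero_mul, add_zero] at h1
      exact h1.symm
    · rw [Finset.card_image_of_injOn hinj]
      omega
  exact ⟨q, hq, by ext z; simp [e, h0]⟩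

/-- Divisibility is transported by affine changes of coordinates, so one vertical line settles the
other two directions. -/
theorem Divides.comp {l : ℂ × ℂ → ℂ} (hl : Divides l) {φ ψ : ℂ × ℂ → ℂ × ℂ}
    (hψφ : ∀ z, ψ (φ z) = z)
    (h1 : (fun z => (φ z).1) ∈ affineFun) (h2 : (fun z => (φ z).2) ∈ affineFun)
    (h3 : (fun z => (ψ z).1) ∈ affineFun) (h4 : (fun z => (ψ z).2) ∈ affineFun) :
    Divides (l ∘ φ) := by
  rintro κ p hp ⟨A, hA, hz⟩
  have hA' : κ ≤ (A.image φ).card := by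
    rwa [Finset.card_image_of_injective _ (Function.LeftInverse.injective hψφ)]
  have hz' : ∀ w ∈ A.image φ, l w = 0 ∧ (p ∘ ψ) w = 0 := by
    intro w hw
    obtain ⟨z, hzA, rfl⟩ := Finset.mem_image.1 hw
    exact ⟨(hz z hzA).1, by simpa [hψφ] using (hz z hzA).2⟩
  obtain ⟨r, hr, e⟩ := hl κ (p ∘ ψ) (comp_mem_polyLT h3 h4 hp) ⟨A.image φ, hA', hz'⟩
  refine ⟨r ∘ φ, comp_mem_polyLT h1 h2 hr, ?_⟩
  ext z
  have := congrFun e (φ z)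
  simpa [hψφ] using this

theorem divides_snd_sub (c : ℂ) : Divides (fun z => z.2 - c) := by
  refine (divides_fst_sub c).comp (φ := fun z => (z.2, z.1)) (ψ := fun z => (z.2, z.1))
    (fun _ => rfl) ?_ ?_ ?_ ?_ <;> rw [mem_affineFun_iff]
  · exact ⟨0, 0, 1, by ext; simp⟩
  · exact ⟨0, 1, 0, by ext; simp⟩
  · exact ⟨0, 0, 1, by ext; simp⟩
  · exact ⟨0, 1, 0, by ext; simp⟩

theorem divides_add_sub (c : ℂ) : Divides (fun z => z.1 + z.2 - c) := by
  refine (divides_fst_sub c).comp (φ := fun z => (z.1 + z.2, z.2)) (ψ := fun z => (z.1 - z.2, z.2))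
    (fun _ => by simp) ?_ ?_ ?_ ?_ <;> rw [mem_affineFun_iff]
  · exact ⟨0, 1, 1, by ext; simp⟩
  · exact ⟨0, 0, 1, by ext; simp⟩
  · exact ⟨0, 1, -1, by ext; simp; ring⟩
  · exact ⟨0, 0, 1, by ext; simp⟩

/-- The forms are split off one by one. Each lowers the degree by one, so the `q`-th needs only `κ -
q` zeros; these must lie off the earlier lines in order to be zeros of the remaining quotient. -/
theorem exists_eq_prod_mul {l : ℕ → ℂ × ℂ → ℂ} (hl : ∀ q, Divides (l q)) {κ : ℕ}
    {p : ℂ × ℂ → ℂ} (hp : p ∈ polyLT κ) (c : ℕ)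
    (h : ∀ q < c, ∃ A : Finset (ℂ × ℂ), κ - q ≤ A.card ∧
      ∀ z ∈ A, l q z = 0 ∧ p z = 0 ∧ ∀ q' < q, l q' z ≠ 0) :
    ∃ r ∈ polyLT (κ - c), p = (∏ q ∈ Finset.range c, l q) * r := by
  induction c with
  | zero => exact ⟨p, hp, by simp⟩
  | succ c ih =>
    obtain ⟨r, hr, e⟩ := ih fun q hq => h q (by omega)
    obtain ⟨A, hA, hz⟩ := h c (by omega)
    have hz' : ∀ z ∈ A, l c z = 0 ∧ r z = 0 := by
      refine fun z hzA => ⟨(hz z hzA).1, ?_⟩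
      have h1 := (hz z hzA).2.1
      rw [e, Pi.mul_apply, Finset.prod_apply] at h1
      refine (mul_eq_zero.1 h1).resolve_left (Finset.prod_ne_zero_iff.2 fun q hq => ?_)
      exact (hz z hzA).2.2 q (Finset.mem_range.1 hq)
    obtain ⟨r', hr', e'⟩ := hl c (κ - c) r hr ⟨A, hA, hz'⟩
    refine ⟨r', hr', ?_⟩
    rw [Finset.prod_range_succ, mul_assoc, ← e', e]

theorem affineFun_pow_le_span (c d : ℂ) (k : ℕ) : affineFun ^ k ≤
    Submodule.span ℂ {p | ∃ s t : ℕ, s + t ≤ k ∧ p = fun z => (z.1 - c) ^ s * (z.2 - d) ^ t} := by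
  induction k with
  | zero =>
    rw [pow_zero, Submodule.one_le]
    exact Submodule.subset_span ⟨0, 0, le_rfl, by ext; simp⟩
  | succ k ih =>
    rw [pow_succ, Submodule.mul_le]
    intro p hp l hl
    obtain ⟨x, y, w, rfl⟩ := mem_affineFun_iff.1 hl
    have h := ih hp
    clear hp hl
    induction h using Submodule.span_induction with
    | mem p hp =>
      obtain ⟨s, t, hst, rfl⟩ := hp
      have e : ((fun z => (z.1 - c) ^ s * (z.2 - d) ^ t) * fun z => x + y * z.1 + w * z.2 :
            ℂ × ℂ → ℂ) = (x + y * c + w * d) • (fun z : ℂ × ℂ => (z.1 - c) ^ s * (z.2 - d) ^ t)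
          + y • (fun z : ℂ × ℂ => (z.1 - c) ^ (s + 1) * (z.2 - d) ^ t)
          + w • (fun z : ℂ × ℂ => (z.1 - c) ^ s * (z.2 - d) ^ (t + 1)) := by
        ext z
        simp only [Pi.mul_apply, Pi.add_apply, Pi.smul_apply, smul_eq_mul]
        ring
      rw [e]
      refine add_mem (add_mem ?_ ?_) ?_ <;>
        refine Submodule.smul_mem _ _ (Submodule.subset_span ⟨_, _, ?_, rfl⟩) <;> omega
    | zero => rw [zero_mul]; exact zero_mem _
    | add p q _ _ hp hq => rw [add_mul]; exact add_mem hp hq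
    | smul a p _ hp => rw [smul_mul_assoc]; exact Submodule.smul_mem _ _ hp

/-! ### Division of symbols -/

/-- The number of linear factors that every symbol of bidegree `d` from `𝒯_m` to `𝒯_{m'}`
contains. -/
def numLines (m m' : ℕ) (d : ℤ × ℤ) : ℕ :=
  ((m : ℤ) - m' + d.1 + d.2).toNat + (-d.1).toNat + (-d.2).toNat

/-- The linear factors of the symbols of bidegree `d` from `𝒯_m` to `𝒯_{m'}`. -/
def lineFactor (m c₁ c₂ q : ℕ) : ℂ × ℂ → ℂ :=
  if q < c₁ then fun z => z.1 + z.2 - ((m : ℂ) - q)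
  else if q < c₁ + c₂ then fun z => z.1 - ((q : ℂ) - c₁)
  else fun z => z.2 - ((q : ℂ) - c₁ - c₂)

theorem divides_lineFactor (m c₁ c₂ q : ℕ) : Divides (lineFactor m c₁ c₂ q) := by
  unfold lineFactor
  split_ifs
  · exact divides_add_sub _
  · exact divides_fst_sub _
  · exact divides_snd_sub _

/-- The antidiagonals come first, in decreasing order: `i + j = m - q` has only `m + 1 - q` lattice
points in the quadrant, just enough for `k ≤ m + 1` after `q` divisions. The other lines have
infinitely many usable points. -/
theorem symbol_eq_prod_mul {m m' k : ℕ} {d : ℤ × ℤ} {p : ℂ × ℂ → ℂ} (hk : k ≤ m + 1)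
    (hp : p ∈ polyLT k) (hpos : ∀ i j : ℕ, p (i, j) ≠ 0 → 0 ≤ i + d.1 ∧ 0 ≤ j + d.2)
    (hmap : ∀ i j : ℕ, i + j ≤ m → p (i, j) ≠ 0 → i + j + d.1 + d.2 ≤ m') :
    ∃ r ∈ polyLT (k - numLines m m' d),
      p = (∏ q ∈ Finset.range (numLines m m' d),
        lineFactor m ((m : ℤ) - m' + d.1 + d.2).toNat (-d.1).toNat q) * r := by
  obtain ⟨a, b⟩ := d
  simp only [numLines] at *
  set c₁ := ((m : ℤ) - m' + a + b).toNat with hc₁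
  set c₂ := (-a).toNat with hc₂
  set c₃ := (-b).toNat with hc₃
  refine exists_eq_prod_mul (divides_lineFactor m c₁ c₂) hp _ fun q hq => ?_
  by_cases h1 : q < c₁
  · refine ⟨(Finset.range (m + 1 - q)).image fun i : ℕ => ((i : ℂ), ((m - q - i : ℕ) : ℂ)), ?_, ?_⟩
    · rw [Finset.card_image_of_injective _ fun i j h => by simpa using (Prod.ext_iff.1 h).1,
        Finset.card_range]
      omega
    · intro z hz
      obtain ⟨i, hi, rfl⟩ := Finset.mem_image.1 hz
      rw [Finset.mem_range] at hi
      refine ⟨?_, ?_, fun q' hq' => ?_⟩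
      · simp only [lineFactor, if_pos h1]
        rw [Nat.cast_sub (by omega), Nat.cast_sub (by omega)]
        ring
      · by_contra h
        have := hmap _ _ (by omega) h
        omega
      · simp only [lineFactor, if_pos (hq'.trans h1)]
        rw [Nat.cast_sub (by omega), Nat.cast_sub (by omega)]
        have : (q' : ℂ) ≠ q := Nat.cast_injective.ne hq'.ne
        intro h
        exact this (by linear_combination h)
  by_cases h2 : q < c₁ + c₂
  -- The offset `m + 1` keeps these points off every antidiagonal already divided out.
  · refine ⟨(Finset.range k).image fun j : ℕ => (((q - c₁ : ℕ) : ℂ), ((m + 1 + j : ℕ) : ℂ)), ?_, ?_⟩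
    · rw [Finset.card_image_of_injective _ fun i j h => by
        have := Nat.cast_injective (Prod.ext_iff.1 h).2; omega, Finset.card_range]
      omega
    · intro z hz
      obtain ⟨j, hj, rfl⟩ := Finset.mem_image.1 hz
      refine ⟨?_, ?_, fun q' hq' => ?_⟩
      · simp only [lineFactor, if_neg h1, if_pos h2]
        rw [Nat.cast_sub (by omega)]
        ring
      · by_contra h
        have := hpos _ _ h
        omega
      · by_cases h3 : q' < c₁
        · simp only [lineFactor, if_pos h3]
          intro h
          have h4 : ((q - c₁ + (m + 1 + j) + q' : ℕ) : ℂ) = (m : ℕ) := by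
            push_cast [Nat.cast_sub (not_lt.1 h1)] at h ⊢
            linear_combination h
          have := Nat.cast_injective h4
          omega
        · simp only [lineFactor, if_neg h3, if_pos (hq'.trans h2)]
          intro h
          rw [Nat.cast_sub (by omega)] at h
          have : (q : ℂ) = q' := by linear_combination h
          have := Nat.cast_injective this
          omega
  -- Abscissas beyond `c₂ + m` avoid both the antidiagonals and the vertical lines `i < c₂`.
  · refine ⟨(Finset.range k).image fun i : ℕ =>
      (((c₂ + m + 1 + i : ℕ) : ℂ), ((q - c₁ - c₂ : ℕ) : ℂ)), ?_, ?_⟩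
    · rw [Finset.card_image_of_injective _ fun i j h => by
        have := Nat.cast_injective (Prod.ext_iff.1 h).1; omega, Finset.card_range]
      omega
    · intro z hz
      obtain ⟨i, hi, rfl⟩ := Finset.mem_image.1 hz
      refine ⟨?_, ?_, fun q' hq' => ?_⟩
      · simp only [lineFactor, if_neg h1, if_neg h2]
        rw [Nat.cast_sub (by omega), Nat.cast_sub (by omega)]
        ring
      · by_contra h
        have := hpos _ _ h
        omega
      · by_cases h3 : q' < c₁
        · simp only [lineFactor, if_pos h3]
          intro h
          have h4 : ((c₂ + m + 1 + i + (q - c₁ - c₂) + q' : ℕ) : ℂ) = (m : ℕ) := by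
            push_cast at h ⊢
            linear_combination h
          have := Nat.cast_injective h4
          omega
        by_cases h5 : q' < c₁ + c₂
        · simp only [lineFactor, if_neg h3, if_pos h5]
          intro h
          have h4 : ((c₂ + m + 1 + i + c₁ : ℕ) : ℂ) = (q' : ℕ) := by
            push_cast at h ⊢
            linear_combination h
          have := Nat.cast_injective h4
          omega
        · simp only [lineFactor, if_neg h3, if_neg h5]
          intro h
          rw [Nat.cast_sub (by omega), Nat.cast_sub (by omega)] at h
          have : (q : ℂ) = q' := by linear_combination h
          have := Nat.cast_injective this
          omega

/-- A symbol whose degree is the least possible in its bidegree divides every other one. -/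
theorem exists_eq_mul_of_minimal {m m' k l : ℕ} {d : ℤ × ℤ} {p p₀ : ℂ × ℂ → ℂ} (hk : k ≤ m)
    (hp : p ∈ affineFun ^ k) (hpos : ∀ i j : ℕ, p (i, j) ≠ 0 → 0 ≤ i + d.1 ∧ 0 ≤ j + d.2)
    (hmap : ∀ i j : ℕ, i + j ≤ m → p (i, j) ≠ 0 → i + j + d.1 + d.2 ≤ m')
    (hl : l ≤ numLines m m' d) (hp₀ : p₀ ∈ affineFun ^ l) (h₀ : p₀ ≠ 0)
    (hpos₀ : ∀ i j : ℕ, p₀ (i, j) ≠ 0 → 0 ≤ i + d.1 ∧ 0 ≤ j + d.2)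
    (hmap₀ : ∀ i j : ℕ, i + j ≤ m → p₀ (i, j) ≠ 0 → i + j + d.1 + d.2 ≤ m') (hne : p ≠ 0) :
    ∃ e : ℕ, l + e ≤ k ∧ ∃ r ∈ affineFun ^ e, p = p₀ * r := by
  obtain ⟨r, hr, e⟩ := symbol_eq_prod_mul (by omega) (by rwa [polyLT_succ] : p ∈ polyLT (k + 1))
    hpos hmap
  -- With more forms than the degree allows, the quotient would lie in `polyLT 0 = ⊥`.
  have hd : numLines m m' d ≤ k := by
    by_contra hd
    rw [show k + 1 - numLines m m' d = 0 by omega] at hr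
    rw [(Submodule.mem_bot ℂ).1 hr, mul_zero] at e
    exact hne e
  obtain ⟨r₀, hr₀, e₀⟩ := symbol_eq_prod_mul (by omega)
    (by rwa [polyLT_succ] : p₀ ∈ polyLT (l + 1)) hpos₀ hmap₀
  -- The degree of `p₀` is at most the number of forms, so its quotient is a constant.
  have hr₁ := polyLT_mono (show l + 1 - numLines m m' d ≤ 1 by omega) hr₀
  rw [polyLT_succ, pow_zero, Submodule.mem_one] at hr₁
  obtain ⟨c, rfl⟩ := hr₁
  have hc : c ≠ 0 := by
    rintro rfl
    exact h₀ (by rw [e₀, map_zero, mul_zero])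
  refine ⟨k - numLines m m' d, by omega, c⁻¹ • r, Submodule.smul_mem _ _ ?_, ?_⟩
  · rwa [Nat.succ_sub hd, polyLT_succ] at hr
  · rw [e₀, e, mul_assoc, mul_smul_comm, ← Algebra.smul_def, smul_smul, inv_mul_cancel₀ hc, one_smul]

/-! ### Homogeneous operators and their symbols -/

/-- `E` maps `x^i y^j` to `p(i, j) x^{i + d₁} y^{j + d₂}`. -/
def ActsBy (E : Module.End ℂ (Smooth U)) (d : ℤ × ℤ) (p : ℂ × ℂ → ℂ) : Prop :=
  ∀ i j : ℕ, (p (i, j) ≠ 0 → 0 ≤ i + d.1 ∧ 0 ≤ j + d.2) ∧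
    E (mono U i j) = p (i, j) • mono U (i + d.1).toNat (j + d.2).toNat

theorem ActsBy.add {E E' : Module.End ℂ (Smooth U)} {d : ℤ × ℤ} {p p' : ℂ × ℂ → ℂ}
    (h : ActsBy E d p) (h' : ActsBy E' d p') : ActsBy (E + E') d (p + p') := by
  intro i j
  refine ⟨fun hne => ?_, ?_⟩
  · by_cases h0 : p (i, j) = 0
    · exact (h' i j).1 (by simpa [h0] using hne)
    · exact (h i j).1 h0
  · rw [LinearMap.add_apply, (h i j).2, (h' i j).2, Pi.add_apply, add_smul]

theorem ActsBy.smul {E : Module.End ℂ (Smooth U)} {d : ℤ × ℤ} {p : ℂ × ℂ → ℂ} (c : ℂ)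
    (h : ActsBy E d p) : ActsBy (c • E) d (c • p) := by
  intro i j
  refine ⟨fun hne => (h i j).1 (right_ne_zero_of_mul hne), ?_⟩
  rw [LinearMap.smul_apply, (h i j).2, Pi.smul_apply, smul_assoc]

theorem actsBy_zero (d : ℤ × ℤ) : ActsBy (0 : Module.End ℂ (Smooth U)) d 0 :=
  fun _ _ => ⟨fun h => absurd rfl h, by simp⟩

theorem actsBy_one : ActsBy (1 : Module.End ℂ (Smooth U)) 0 1 := fun _ _ => ⟨by simp, by simp⟩

/-- The symbol of a product in which the right factor has bidegree `d`. -/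
def shiftFun (d : ℤ × ℤ) (p : ℂ × ℂ → ℂ) : ℂ × ℂ → ℂ := p ∘ fun z => (z.1 + d.1, z.2 + d.2)

theorem ActsBy.mul {E E' : Module.End ℂ (Smooth U)} {d d' : ℤ × ℤ} {p p' : ℂ × ℂ → ℂ}
    (h : ActsBy E d p) (h' : ActsBy E' d' p') :
    ActsBy (E * E') (d + d') (shiftFun d' p * p') := by
  intro i j
  by_cases h0 : p' (i, j) = 0
  · refine ⟨fun hne => absurd (by simp [h0]) hne, ?_⟩
    rw [Module.End.mul_apply, (h' i j).2, h0]
    simp [h0]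
  · obtain ⟨hi, hj⟩ := (h' i j).1 h0
    -- Where `p'` does not vanish, the shifted argument is again a pair of natural numbers, so the
    -- hypothesis on `E` applies there.
    have e : ((i : ℂ) + d'.1, (j : ℂ) + d'.2)
        = (((i + d'.1).toNat : ℂ), ((j + d'.2).toNat : ℂ)) := by
      rw [← Int.cast_natCast (i + d'.1).toNat, ← Int.cast_natCast (j + d'.2).toNat,
        Int.toNat_of_nonneg hi, Int.toNat_of_nonneg hj]
      push_cast
      rfl
    have h1 := h (i + d'.1).toNat (j + d'.2).toNat
    rw [← e, Int.toNat_of_nonneg hi, Int.toNat_of_nonneg hj] at h1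
    refine ⟨fun hne => ?_, ?_⟩
    · have := h1.1 (left_ne_zero_of_mul hne)
      simp only [Prod.fst_add, Prod.snd_add]
      omega
    · rw [Module.End.mul_apply, (h' i j).2, map_smul, h1.2, smul_smul, mul_comm (p' _)]
      simp only [Prod.fst_add, Prod.snd_add, Pi.mul_apply, shiftFun, Function.comp]
      rw [add_assoc, add_assoc, add_comm d.1, add_comm d.2]

theorem shiftFun_mem {k : ℕ} {p : ℂ × ℂ → ℂ} (d : ℤ × ℤ) (hp : p ∈ affineFun ^ k) :
    shiftFun d p ∈ affineFun ^ k := by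
  refine comp_mem_affineFun_pow ?_ ?_ hp <;> rw [mem_affineFun_iff]
  · exact ⟨d.1, 1, 0, by ext; simp; ring⟩
  · exact ⟨d.2, 0, 1, by ext; simp; ring⟩

/-- The operators of order at most `k` and bidegree `d` with a symbol of degree at most `k`. -/
def homog (U : Opens (ℂ × ℂ)) (k : ℕ) (d : ℤ × ℤ) : Submodule ℂ (Module.End ℂ (Smooth U)) where
  carrier := {E | E ∈ ordSub U k ∧ ∃ p ∈ affineFun ^ k, ActsBy E d p}
  add_mem' := by
    rintro E E' ⟨hE, p, hp, h⟩ ⟨hE', p', hp', h'⟩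
    exact ⟨add_mem hE hE', p + p', add_mem hp hp', h.add h'⟩
  zero_mem' := ⟨zero_mem _, 0, zero_mem _, actsBy_zero d⟩
  smul_mem' := by
    rintro c E ⟨hE, p, hp, h⟩
    exact ⟨Submodule.smul_mem _ _ hE, c • p, Submodule.smul_mem _ _ hp, h.smul c⟩

theorem mul_mem_homog {k l : ℕ} {d d' : ℤ × ℤ} {E E' : Module.End ℂ (Smooth U)}
    (h : E ∈ homog U k d) (h' : E' ∈ homog U l d') : E * E' ∈ homog U (k + l) (d + d') := by
  obtain ⟨hE, p, hp, h⟩ := h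
  obtain ⟨hE', p', hp', h'⟩ := h'
  refine ⟨mul_mem_ordSub hE hE', _, ?_, h.mul h'⟩
  rw [pow_add]
  exact Submodule.mul_mem_mul (shiftFun_mem _ hp) hp'

theorem one_mem_homog : (1 : Module.End ℂ (Smooth U)) ∈ homog U 0 0 :=
  ⟨one_mem_ordSub, 1, by rw [pow_zero]; exact Submodule.one_le.1 le_rfl, actsBy_one⟩

theorem pow_mem_homog {k : ℕ} {d : ℤ × ℤ} {E : Module.End ℂ (Smooth U)}
    (h : E ∈ homog U k d) (s : ℕ) : E ^ s ∈ homog U (s * k) (s • d) := by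
  induction s with
  | zero => simpa using one_mem_homog (U := U)
  | succ s ih =>
    rw [pow_succ, succ_nsmul, Nat.succ_mul]
    exact mul_mem_homog ih h

theorem homog_mono {k l : ℕ} (h : k ≤ l) (d : ℤ × ℤ) : homog U k d ≤ homog U l d := by
  rintro E ⟨hE, p, hp, h'⟩
  exact ⟨ordSub_mono h hE, p, affineFun_pow_mono h hp, h'⟩

theorem actsBy_cx : ActsBy (mulOp U (cx U)) (1, 0) 1 := by
  refine fun i j => ⟨fun _ => ⟨by positivity, by simp⟩, ?_⟩
  rw [mulOp_apply, mono, mono, ← mul_assoc, ← pow_succ']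
  simp only [Pi.one_apply, one_smul, add_zero, Int.toNat_natCast]
  rw [show ((i : ℤ) + 1).toNat = i + 1 by omega]

theorem actsBy_cy : ActsBy (mulOp U (cy U)) (0, 1) 1 := by
  refine fun i j => ⟨fun _ => ⟨by simp, by positivity⟩, ?_⟩
  rw [mulOp_apply, mono, mono, mul_left_comm, ← pow_succ']
  simp only [Pi.one_apply, one_smul, add_zero, Int.toNat_natCast]
  rw [show ((j : ℤ) + 1).toNat = j + 1 by omega]

theorem actsBy_dx : ActsBy (dx U) (-1, 0) Prod.fst := by
  refine fun i j => ⟨fun h => ?_, ?_⟩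
  · have : i ≠ 0 := by rintro rfl; simp at h
    simp only
    omega
  · rw [dx_mono]
    simp only [add_zero, Int.toNat_natCast]
    congr 2
    omega

theorem actsBy_dy : ActsBy (dy U) (0, -1) Prod.snd := by
  refine fun i j => ⟨fun h => ?_, ?_⟩
  · have : j ≠ 0 := by rintro rfl; simp at h
    simp only
    omega
  · rw [dy_mono]
    simp only [add_zero, Int.toNat_natCast]
    congr 2
    omega

theorem cx_mem_homog : mulOp U (cx U) ∈ homog U 0 (1, 0) :=
  ⟨mulOp_mem_ordSub _, 1, by rw [pow_zero]; exact Submodule.one_le.1 le_rfl, actsBy_cx⟩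

theorem cy_mem_homog : mulOp U (cy U) ∈ homog U 0 (0, 1) :=
  ⟨mulOp_mem_ordSub _, 1, by rw [pow_zero]; exact Submodule.one_le.1 le_rfl, actsBy_cy⟩

theorem dx_mem_homog : dx U ∈ homog U 1 (-1, 0) :=
  ⟨dx_mem_ordSub, Prod.fst, by rw [pow_one]; exact Submodule.subset_span (by simp), actsBy_dx⟩

theorem dy_mem_homog : dy U ∈ homog U 1 (0, -1) :=
  ⟨dy_mem_ordSub, Prod.snd, by rw [pow_one]; exact Submodule.subset_span (by simp), actsBy_dy⟩

/-- The span of all monomials. -/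
def polySpan (U : Opens (ℂ × ℂ)) : Submodule ℂ (Smooth U) :=
  Submodule.span ℂ (Set.range fun e : ℕ × ℕ => mono U e.1 e.2)

theorem mul_mono_mem_polySpan (i j : ℕ) (f : Smooth U) (hf : f ∈ polySpan U) :
    f * mono U i j ∈ polySpan U := by
  induction hf using Submodule.span_induction with
  | mem f hf =>
    obtain ⟨e, rfl⟩ := hf
    simp only [mono_mul]
    exact Submodule.subset_span ⟨(_, _), rfl⟩
  | zero => rw [zero_mul]; exact zero_mem _
  | add f g _ _ hf hg => rw [add_mul]; exact add_mem hf hg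
  | smul c f _ hf => rw [smul_mul_assoc]; exact Submodule.smul_mem _ _ hf

/-- The coefficients are polynomials by triangularity, and each `x^a y^b ∂_x^s ∂_y^t` is homogeneous
with a symbol of degree at most `s + t`. -/
theorem mem_iSup_homog {k : ℕ} {T : Module.End ℂ (Smooth U)} (hT : T ∈ ordSub U k)
    (h : ∀ i j : ℕ, i + j ≤ k → T (mono U i j) ∈ polySpan U) : T ∈ ⨆ d, homog U k d := by
  obtain ⟨f, rfl⟩ := hT
  have hf := coeff_mem_of_apply_mono_mem mul_mono_mem_polySpan h
  refine Submodule.sum_mem _ fun s hs => Submodule.sum_mem _ fun t ht => ?_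
  simp only [Finset.mem_range] at hs ht
  have h1 := hf s t (by omega)
  generalize f s t = g at h1
  induction h1 using Submodule.span_induction with
  | mem g hg =>
    obtain ⟨⟨a, b⟩, rfl⟩ := hg
    have h2 := mul_mem_homog (mul_mem_homog
      (mul_mem_homog (pow_mem_homog (cx_mem_homog (U := U)) a) (pow_mem_homog cy_mem_homog b))
      (pow_mem_homog dx_mem_homog s)) (pow_mem_homog dy_mem_homog t)
    rw [← mulOp_pow, ← mulOp_pow, ← mulOp_mul] at h2
    exact le_iSup (homog U k) _ (homog_mono (by omega) _ h2)
  | zero => rw [mulOp_zero, zero_mul, zero_mul]; exact zero_mem _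
  | add f g _ _ hf hg => rw [mulOp_add, add_mul, add_mul]; exact add_mem hf hg
  | smul c f _ hf =>
    rw [mulOp_smul, smul_mul_assoc, smul_mul_assoc]
    exact Submodule.smul_mem _ _ hf

/-! ### Operators between triangular modules -/

/-- `E` maps `𝒯_m` into `𝒯_{m'}`. -/
def MapsTri (m m' : ℕ) (E : Module.End ℂ (Smooth U)) : Prop :=
  ∀ f ∈ triModule U m, E f ∈ triModule U m'

theorem mono_mem_triModule {i j m : ℕ} (h : i + j ≤ m) : mono U i j ∈ triModule U m :=
  Submodule.subset_span ⟨i, j, h, rfl⟩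

theorem triModule_le_polySpan (m : ℕ) : triModule U m ≤ polySpan U := by
  refine Submodule.span_le.2 ?_
  rintro _ ⟨i, j, _, rfl⟩
  exact Submodule.subset_span ⟨(i, j), rfl⟩

theorem mapsTri_of_mono {m m' : ℕ} {E : Module.End ℂ (Smooth U)}
    (h : ∀ i j : ℕ, i + j ≤ m → E (mono U i j) ∈ triModule U m') : MapsTri m m' E := by
  have : triModule U m ≤ (triModule U m').comap E := by
    refine Submodule.span_le.2 ?_
    rintro _ ⟨i, j, hij, rfl⟩
    exact h i j hij
  exact fun f hf => this hf

theorem MapsTri.mul {m m' m'' : ℕ} {E E' : Module.End ℂ (Smooth U)} (h : MapsTri m' m'' E)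
    (h' : MapsTri m m' E') : MapsTri m m'' (E * E') := fun f hf => h _ (h' f hf)

theorem mapsTri_one (m : ℕ) : MapsTri m m (1 : Module.End ℂ (Smooth U)) := fun _ hf => hf

theorem MapsTri.pow {m : ℕ} {E : Module.End ℂ (Smooth U)} (h : MapsTri m m E) (s : ℕ) :
    MapsTri m m (E ^ s) := by
  induction s with
  | zero => simpa using mapsTri_one m
  | succ s ih => rw [pow_succ]; exact ih.mul h

theorem ActsBy.mapsTri {E : Module.End ℂ (Smooth U)} {d : ℤ × ℤ} {p : ℂ × ℂ → ℂ} {m m' : ℕ}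
    (h : ActsBy E d p)
    (h' : ∀ i j : ℕ, i + j ≤ m → p (i, j) ≠ 0 → i + j + d.1 + d.2 ≤ m') : MapsTri m m' E := by
  refine mapsTri_of_mono fun i j hij => ?_
  rw [(h i j).2]
  by_cases h0 : p (i, j) = 0
  · rw [h0, zero_smul]; exact zero_mem _
  · have h1 := (h i j).1 h0
    have h2 := h' i j hij h0
    exact Submodule.smul_mem _ _ (mono_mem_triModule (by omega))

theorem coeff_triModule [Nonempty U] {φ : Smooth U →ₗ[ℂ] (ℕ × ℕ →₀ ℂ)}
    (hφ : ∀ i j, φ (mono U i j) = Finsupp.single (i, j) 1) {m : ℕ} {f : Smooth U}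
    (hf : f ∈ triModule U m) {a b : ℕ} (hab : m < a + b) : φ f (a, b) = 0 := by
  induction hf using Submodule.span_induction with
  | mem f hf =>
    obtain ⟨i, j, hij, rfl⟩ := hf
    have := hφ i j
    rw [mono] at this
    rw [this, Finsupp.single_eq_of_ne]
    rintro ⟨⟩
    omega
  | zero => simp
  | add f g _ _ hf hg => simp [hf, hg]
  | smul c f _ hf => simp [hf]

theorem coeff_monomialLine [Nonempty U] {φ : Smooth U →ₗ[ℂ] (ℕ × ℕ →₀ ℂ)}
    (hφ : ∀ i j, φ (mono U i j) = Finsupp.single (i, j) 1) {i j : ℤ} {f : Smooth U}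
    (hf : f ∈ monomialLine U i j) {a b : ℕ} (hab : ¬ ((a : ℤ) = i ∧ (b : ℤ) = j)) :
    φ f (a, b) = 0 := by
  induction hf using Submodule.span_induction with
  | mem f hf =>
    obtain ⟨i, j, rfl, rfl, rfl⟩ := hf
    have := hφ i j
    rw [mono] at this
    rw [this, Finsupp.single_eq_of_ne]
    rintro ⟨⟩
    simp at hab
  | zero => simp
  | add f g _ _ hf hg => simp [hf, hg]
  | smul c f _ hf => simp [hf]

theorem ActsBy.apply_mem_monomialLine {E : Module.End ℂ (Smooth U)} {d : ℤ × ℤ}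
    {p : ℂ × ℂ → ℂ} (h : ActsBy E d p) (i j : ℕ) :
    E (mono U i j) ∈ monomialLine U (i + d.1) (j + d.2) := by
  rw [(h i j).2]
  by_cases h0 : p (i, j) = 0
  · rw [h0, zero_smul]; exact zero_mem _
  · have h1 := (h i j).1 h0
    exact Submodule.smul_mem _ _ (Submodule.subset_span
      ⟨_, _, Int.toNat_of_nonneg h1.1, Int.toNat_of_nonneg h1.2, rfl⟩)

/-- A nonzero multiple of one monomial lies in no other monomial line. -/
theorem ActsBy.bidegree_unique [Nonempty U] {E : Module.End ℂ (Smooth U)} {d d' : ℤ × ℤ}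
    {p : ℂ × ℂ → ℂ} (h : ActsBy E d p) {i j : ℕ} (h0 : p (i, j) ≠ 0)
    (h' : E (mono U i j) ∈ monomialLine U (i + d'.1) (j + d'.2)) : d' = d := by
  obtain ⟨φ, hφ⟩ := exists_coeff (U := U)
  by_contra hne
  have h1 := (h i j).1 h0
  have h2 := coeff_monomialLine hφ h' (a := (i + d.1).toNat) (b := (j + d.2).toNat) (by
    rintro ⟨e1, e2⟩
    apply hne
    ext <;> omega)
  rw [(h i j).2, map_smul, hφ] at h2
  simp [h0] at h2

/-- Pieces of different bidegrees send a given monomial to different monomials, so nothing cancels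
and each piece inherits the mapping property. The bound `k ≤ m` makes the values on `𝒯_m` determine
all coefficients. -/
theorem exists_homogeneous_decomposition [Nonempty U] {k m m' : ℕ} (hk : k ≤ m)
    {T : Module.End ℂ (Smooth U)} (hT : T ∈ ordSub U k) (hm : MapsTri m m' T) :
    ∃ (F : Finset (ℤ × ℤ)) (E : ℤ × ℤ → Module.End ℂ (Smooth U)), T = ∑ d ∈ F, E d ∧
      ∀ d ∈ F, E d ∈ ordSub U k ∧ ∃ p ∈ affineFun ^ k, ActsBy (E d) d p ∧
        ∀ i j : ℕ, i + j ≤ m → p (i, j) ≠ 0 → i + j + d.1 + d.2 ≤ m' := by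
  have h := mem_iSup_homog hT fun i j hij =>
    triModule_le_polySpan m' (hm _ (mono_mem_triModule (hij.trans hk)))
  obtain ⟨E, hE, hsum⟩ := (Submodule.mem_iSup_iff_exists_finsupp _ _).1 h
  choose hE1 p hp hact using hE
  refine ⟨E.support, E, hsum.symm, fun d hd => ⟨hE1 d, p d, hp d, hact d, fun i j hij h0 => ?_⟩⟩
  by_contra hgt
  obtain ⟨φ, hφ⟩ := exists_coeff (U := U)
  have h1 := (hact d i j).1 h0
  have h2 := coeff_triModule hφ (hm _ (mono_mem_triModule hij))
    (a := (i + d.1).toNat) (b := (j + d.2).toNat) (by omega)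
  rw [← hsum, Finsupp.sum, LinearMap.sum_apply, map_sum, Finsupp.finsetSum_apply,
    Finset.sum_eq_single d] at h2
  · rw [(hact d i j).2, map_smul, hφ] at h2
    simp [h0] at h2
  · intro d' _ hne
    refine coeff_monomialLine hφ ((hact d').apply_mem_monomialLine i j) ?_
    rintro ⟨e1, e2⟩
    apply hne
    ext <;> omega
  · intro hd'
    exact absurd hd hd'

/-! ### The monomials as homogeneous operators -/

/-- `E` is an operator `𝒯_m → 𝒯_{m'}` of order at most `k` and bidegree `d`, whose symbol has degree
at most `k` and does not vanish for large exponents. -/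
def IsTriOp (m m' k : ℕ) (d : ℤ × ℤ) (E : Module.End ℂ (Smooth U)) : Prop :=
  E ∈ ordSub U k ∧ MapsTri m m' E ∧ ∃ p ∈ affineFun ^ k, ActsBy E d p ∧
    ∃ N : ℕ, ∀ i j : ℕ, N ≤ i → N ≤ j → p (i, j) ≠ 0

theorem IsTriOp.mul {m m' m'' k k' : ℕ} {d d' : ℤ × ℤ} {E E' : Module.End ℂ (Smooth U)}
    (h : IsTriOp m' m'' k d E) (h' : IsTriOp m m' k' d' E') :
    IsTriOp m m'' (k + k') (d + d') (E * E') := by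
  obtain ⟨h1, h2, p, hp, h3, N, hN⟩ := h
  obtain ⟨h1', h2', p', hp', h3', N', hN'⟩ := h'
  refine ⟨mul_mem_ordSub h1 h1', h2.mul h2', _, ?_, h3.mul h3',
    -- The threshold leaves room for the shift by `d'` before the bound `N` is applied.
    N + N' + d'.1.natAbs + d'.2.natAbs, fun i j hi hj => ?_⟩
  · rw [pow_add]
    exact Submodule.mul_mem_mul (shiftFun_mem _ hp) hp'
  · refine mul_ne_zero ?_ (hN' i j (by omega) (by omega))
    have e : ((i : ℂ) + d'.1, (j : ℂ) + d'.2)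
        = (((i + d'.1).toNat : ℂ), ((j + d'.2).toNat : ℂ)) := by
      rw [← Int.cast_natCast (i + d'.1).toNat, ← Int.cast_natCast (j + d'.2).toNat,
        Int.toNat_of_nonneg (by omega), Int.toNat_of_nonneg (by omega)]
      push_cast
      rfl
    simp only [shiftFun, Function.comp, e]
    exact hN _ _ (by omega) (by omega)

theorem isTriOp_one (m : ℕ) : IsTriOp m m 0 0 (1 : Module.End ℂ (Smooth U)) :=
  ⟨one_mem_ordSub, mapsTri_one m, 1, by rw [pow_zero]; exact Submodule.one_le.1 le_rfl,
    actsBy_one, 0, by simp⟩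

theorem IsTriOp.pow {m k : ℕ} {d : ℤ × ℤ} {E : Module.End ℂ (Smooth U)}
    (h : IsTriOp m m k d E) (s : ℕ) : IsTriOp m m (s * k) (s • d) (E ^ s) := by
  induction s with
  | zero => simpa using isTriOp_one (U := U) m
  | succ s ih =>
    rw [pow_succ, succ_nsmul, Nat.succ_mul]
    exact ih.mul h

theorem triModule_mono {m m' : ℕ} (h : m ≤ m') : triModule U m ≤ triModule U m' := by
  refine Submodule.span_mono ?_
  rintro _ ⟨i, j, hij, rfl⟩
  exact ⟨i, j, hij.trans h, rfl⟩

theorem IsTriOp.mono {m m' m'' k : ℕ} {d : ℤ × ℤ} {E : Module.End ℂ (Smooth U)}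
    (h : IsTriOp m m' k d E) (hm : m' ≤ m'') : IsTriOp m m'' k d E :=
  ⟨h.1, fun f hf => triModule_mono hm (h.2.1 f hf), h.2.2⟩

theorem isTriOp_prod_ofFn {m : ℕ} {l : ℕ} {k : Fin l → ℕ} {d : Fin l → ℤ × ℤ}
    {E : Fin l → Module.End ℂ (Smooth U)} (h : ∀ i, IsTriOp m m (k i) (d i) (E i)) :
    IsTriOp m m (∑ i, k i) (∑ i, d i) (List.ofFn E).prod := by
  induction l with
  | zero => simpa using isTriOp_one (U := U) m
  | succ l ih =>
    rw [List.ofFn_succ, List.prod_cons, Fin.sum_univ_succ, Fin.sum_univ_succ]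
    exact (h 0).mul (ih fun i => h i.succ)

theorem isTriOp_cx (m : ℕ) : IsTriOp m (m + 1) 0 (1, 0) (mulOp U (cx U)) :=
  ⟨mulOp_mem_ordSub _, actsBy_cx.mapsTri fun i j hij _ => by simp; omega, 1,
    by rw [pow_zero]; exact Submodule.one_le.1 le_rfl, actsBy_cx, 0, by simp⟩

theorem isTriOp_cy (m : ℕ) : IsTriOp m (m + 1) 0 (0, 1) (mulOp U (cy U)) :=
  ⟨mulOp_mem_ordSub _, actsBy_cy.mapsTri fun i j hij _ => by simp; omega, 1,
    by rw [pow_zero]; exact Submodule.one_le.1 le_rfl, actsBy_cy, 0, by simp⟩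

/-- The truncated `m - 1` is correct also for `m = 0`, since constants are killed. -/
theorem isTriOp_dx (m : ℕ) : IsTriOp m (m - 1) 1 (-1, 0) (dx U) := by
  refine ⟨dx_mem_ordSub, actsBy_dx.mapsTri fun i j hij h => ?_, Prod.fst, ?_, actsBy_dx, 1, ?_⟩
  · have : i ≠ 0 := by rintro rfl; simp at h
    simp only
    omega
  · rw [pow_one]; exact Submodule.subset_span (by simp)
  · intro i j hi _
    exact Nat.cast_ne_zero.2 (by omega)

theorem isTriOp_dy (m : ℕ) : IsTriOp m (m - 1) 1 (0, -1) (dy U) := by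
  refine ⟨dy_mem_ordSub, actsBy_dy.mapsTri fun i j hij h => ?_, Prod.snd, ?_, actsBy_dy, 1, ?_⟩
  · have : j ≠ 0 := by rintro rfl; simp at h
    simp only
    omega
  · rw [pow_one]; exact Submodule.subset_span (by simp)
  · intro i j _ hj
    exact Nat.cast_ne_zero.2 (by omega)

/-! ### Symbols of the Euler factors and of the generators -/

theorem sub_smul_eq (c : ℂ) (E F : Module.End ℂ (Smooth U)) : E - c • F = E + (-c) • F :=
  (sub_eq_add_neg E (c • F)).trans (congrArg (E + ·) (neg_smul c F).symm)

theorem actsBy_x_dx : ActsBy (mulOp U (cx U) * dx U) 0 Prod.fst := by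
  have h := actsBy_cx.mul (actsBy_dx (U := U))
  rw [show shiftFun _ 1 = 1 from rfl, one_mul] at h
  exact h

theorem actsBy_y_dy : ActsBy (mulOp U (cy U) * dy U) 0 Prod.snd := by
  have h := actsBy_cy.mul (actsBy_dy (U := U))
  rw [show shiftFun _ 1 = 1 from rfl, one_mul] at h
  exact h

theorem actsBy_euler (c : ℂ) : ActsBy (mulOp U (cx U) * dx U + mulOp U (cy U) * dy U
    + c • (1 : Module.End ℂ (Smooth U))) 0 (fun z => z.1 + z.2 + c) := by
  have h := (actsBy_x_dx.add actsBy_y_dy).add (actsBy_one (U := U) |>.smul c)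
  have e : (Prod.fst + Prod.snd + c • 1 : ℂ × ℂ → ℂ) = fun z => z.1 + z.2 + c := by
    ext; simp
  rwa [e] at h

theorem euler_mem_ordSub (c : ℂ) : mulOp U (cx U) * dx U + mulOp U (cy U) * dy U
    + c • (1 : Module.End ℂ (Smooth U)) ∈ ordSub U 1 :=
  add_mem (add_mem (mulOp_mul_mem_ordSub _ dx_mem_ordSub) (mulOp_mul_mem_ordSub _ dy_mem_ordSub))
    (Submodule.smul_mem _ _ (ordSub_mono zero_le_one one_mem_ordSub))

/-- The constant is chosen to kill the part of top degree `m + 1`. -/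
theorem isTriOp_euler (m : ℕ) : IsTriOp (m + 1) m 1 0 (mulOp U (cx U) * dx U
    + mulOp U (cy U) * dy U + (-((m + 1 : ℕ) : ℂ)) • (1 : Module.End ℂ (Smooth U))) := by
  refine ⟨euler_mem_ordSub _, (actsBy_euler _).mapsTri fun i j hij h => ?_, _, ?_, actsBy_euler _,
    m + 2, fun i j hi hj h => ?_⟩
  · by_contra hlt
    have : i + j = m + 1 := by simp at hlt; omega
    exact h (by rw [← this]; push_cast; ring)
  · rw [pow_one, mem_affineFun_iff]
    exact ⟨-((m + 1 : ℕ) : ℂ), 1, 1, by ext; simp; ring⟩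
  · have h1 : ((i + j : ℕ) : ℂ) = (m + 1 : ℕ) := by
      rw [Nat.cast_add]
      linear_combination h
    have := Nat.cast_injective h1
    omega

/-- The bidegrees of the generators `J¹, …, J⁸`. -/
def genDeg : Fin 8 → ℤ × ℤ :=
  ![(1, 0), (0, 1), (-1, 1), (-1, 0), (0, -1), (1, -1), 0, 0]

theorem mulOp_comm (f g : Smooth U) : mulOp U f * mulOp U g = mulOp U g * mulOp U f := by
  rw [← mulOp_mul, ← mulOp_mul, mul_comm]

theorem actsBy_genJ_six (m : ℕ) :
    ActsBy (genJ U m 6) 0 (fun z => z.1 - (m : ℂ) / 3) := by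
  have h := actsBy_x_dx.add ((actsBy_one (U := U)).smul (-((m : ℂ) / 3)))
  have e : genJ U m 6 = mulOp U (cx U) * dx U + (-((m : ℂ) / 3)) • 1 := by
    exact sub_smul_eq _ _ _
  rw [e]
  convert h using 1
  ext; simp [sub_eq_add_neg]

theorem actsBy_genJ_seven (m : ℕ) :
    ActsBy (genJ U m 7) 0 (fun z => z.2 - (m : ℂ) / 3) := by
  have h := actsBy_y_dy.add ((actsBy_one (U := U)).smul (-((m : ℂ) / 3)))
  have e : genJ U m 7 = mulOp U (cy U) * dy U + (-((m : ℂ) / 3)) • 1 := by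
    exact sub_smul_eq _ _ _
  rw [e]
  convert h using 1
  ext; simp [sub_eq_add_neg]

theorem natCast_sub_third_ne_zero {m i : ℕ} (h : m < i) : (i : ℂ) - (m : ℂ) / 3 ≠ 0 := by
  intro h0
  have h1 : ((3 * i : ℕ) : ℂ) = m := by
    push_cast
    linear_combination 3 * h0
  have := Nat.cast_injective h1
  omega

theorem genJ_zero (m : ℕ) : genJ U m 0 = mulOp U (cx U) * (mulOp U (cx U) * dx U
    + mulOp U (cy U) * dy U + (-(m : ℂ)) • (1 : Module.End ℂ (Smooth U))) := by
  change mulOp U (cx U) ^ 2 * dx U + mulOp U (cx U) * mulOp U (cy U) * dy U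
    - (m : ℂ) • mulOp U (cx U) = _
  rw [sub_smul_eq, mul_add, mul_add, mul_smul_comm, mul_one, sq, mul_assoc,
    mul_assoc]

theorem genJ_one (m : ℕ) : genJ U m 1 = mulOp U (cy U) * (mulOp U (cx U) * dx U
    + mulOp U (cy U) * dy U + (-(m : ℂ)) • (1 : Module.End ℂ (Smooth U))) := by
  change mulOp U (cx U) * mulOp U (cy U) * dx U + mulOp U (cy U) ^ 2 * dy U
    - (m : ℂ) • mulOp U (cy U) = _
  rw [sub_smul_eq, mul_add, mul_add, mul_smul_comm, mul_one, sq, mulOp_comm (cx U),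
    mul_assoc, mul_assoc]

/-- The Euler factor kills degree `m` before multiplication by `f` raises the degree by one. -/
theorem isTriOp_of_shift {m : ℕ} {d : ℤ × ℤ} {f : Smooth U} (hd : d.1 + d.2 = 1)
    (hf : ActsBy (mulOp U f) d 1) :
    IsTriOp m m 1 d (mulOp U f * (mulOp U (cx U) * dx U
      + mulOp U (cy U) * dy U + (-(m : ℂ)) • (1 : Module.End ℂ (Smooth U)))) := by
  have h := hf.mul (actsBy_euler (U := U) (-(m : ℂ)))
  have e : shiftFun 0 1 * (fun z => z.1 + z.2 + -(m : ℂ)) = fun z => z.1 + z.2 + -(m : ℂ) := by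
    ext; simp [shiftFun]
  rw [e, add_zero] at h
  refine ⟨mulOp_mul_mem_ordSub _ (euler_mem_ordSub _), h.mapsTri fun i j hij h0 => ?_, _, ?_, h,
    m + 1, fun i j hi hj h0 => ?_⟩
  · have : i + j ≠ m := by
      rintro rfl
      exact h0 (by push_cast; ring)
    omega
  · rw [pow_one, mem_affineFun_iff]
    exact ⟨-(m : ℂ), 1, 1, by ext; simp; ring⟩
  · have h1 : ((i + j : ℕ) : ℂ) = m := by
      rw [Nat.cast_add]
      linear_combination h0
    have := Nat.cast_injective h1
    omega

theorem isTriOp_of_nonpos {m : ℕ} {d : ℤ × ℤ} {E : Module.End ℂ (Smooth U)} {p : ℂ × ℂ → ℂ}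
    (hd : d.1 + d.2 ≤ 0) (hE : E ∈ ordSub U 1) (hp : p ∈ affineFun) (h : ActsBy E d p)
    (h0 : ∀ i j : ℕ, m < i → m < j → p (i, j) ≠ 0) : IsTriOp m m 1 d E :=
  ⟨hE, h.mapsTri fun i j hij _ => by omega, p, by rwa [pow_one], h, m + 1, h0⟩

theorem isTriOp_genJ (m : ℕ) (i : Fin 8) : IsTriOp m m 1 (genDeg i) (genJ U m i) := by
  have hfst : (Prod.fst : ℂ × ℂ → ℂ) ∈ affineFun := Submodule.subset_span (by simp)
  have hsnd : (Prod.snd : ℂ × ℂ → ℂ) ∈ affineFun := Submodule.subset_span (by simp)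
  have hx : ∀ i j : ℕ, m < i → m < j → (Prod.fst ((i : ℂ), (j : ℂ)) : ℂ) ≠ 0 :=
    fun i j hi _ => Nat.cast_ne_zero.2 (by omega)
  have hy : ∀ i j : ℕ, m < i → m < j → (Prod.snd ((i : ℂ), (j : ℂ)) : ℂ) ≠ 0 :=
    fun i j _ hj => Nat.cast_ne_zero.2 (by omega)
  have hone : (1 : Module.End ℂ (Smooth U)) ∈ ordSub U 1 := ordSub_mono zero_le_one one_mem_ordSub
  fin_cases i
  · change IsTriOp m m 1 (1, 0) (genJ U m 0)
    rw [genJ_zero]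
    exact isTriOp_of_shift (by simp) actsBy_cx
  · change IsTriOp m m 1 (0, 1) (genJ U m 1)
    rw [genJ_one]
    exact isTriOp_of_shift (by simp) actsBy_cy
  · change IsTriOp m m 1 (-1, 1) (mulOp U (cy U) * dx U)
    have h := actsBy_cy.mul (actsBy_dx (U := U))
    rw [show shiftFun _ 1 = 1 from rfl, one_mul] at h
    exact isTriOp_of_nonpos (by simp) (mulOp_mul_mem_ordSub _ dx_mem_ordSub) hfst h hx
  · change IsTriOp m m 1 (-1, 0) (dx U)
    exact isTriOp_of_nonpos (by simp) dx_mem_ordSub hfst actsBy_dx hx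
  · change IsTriOp m m 1 (0, -1) (dy U)
    exact isTriOp_of_nonpos (by simp) dy_mem_ordSub hsnd actsBy_dy hy
  · change IsTriOp m m 1 (1, -1) (mulOp U (cx U) * dy U)
    have h := actsBy_cx.mul (actsBy_dy (U := U))
    rw [show shiftFun _ 1 = 1 from rfl, one_mul] at h
    exact isTriOp_of_nonpos (by simp) (mulOp_mul_mem_ordSub _ dy_mem_ordSub) hsnd h hy
  · change IsTriOp m m 1 0 (genJ U m 6)
    refine isTriOp_of_nonpos (by simp) ?_ ?_ (actsBy_genJ_six m)
      fun i j hi _ => natCast_sub_third_ne_zero hi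
    · change mulOp U (cx U) * dx U - ((m : ℂ) / 3) • 1 ∈ ordSub U 1
      rw [sub_smul_eq]
      exact add_mem (mulOp_mul_mem_ordSub _ dx_mem_ordSub) (Submodule.smul_mem _ _ hone)
    · exact mem_affineFun_iff.2 ⟨-((m : ℂ) / 3), 1, 0, by ext; simp; ring⟩
  · change IsTriOp m m 1 0 (genJ U m 7)
    refine isTriOp_of_nonpos (by simp) ?_ ?_ (actsBy_genJ_seven m)
      fun i j _ hj => natCast_sub_third_ne_zero hj
    · change mulOp U (cy U) * dy U - ((m : ℂ) / 3) • 1 ∈ ordSub U 1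
      rw [sub_smul_eq]
      exact add_mem (mulOp_mul_mem_ordSub _ dy_mem_ordSub) (Submodule.smul_mem _ _ hone)
    · exact mem_affineFun_iff.2 ⟨-((m : ℂ) / 3), 0, 1, by ext; simp; ring⟩

/-! ### Powers of derivatives and coordinates; the prefactors -/

theorem isTriOp_dx_pow (m s : ℕ) : IsTriOp m (m - s) s (-s, 0) (dx U ^ s) := by
  induction s with
  | zero => simpa [← Prod.zero_eq_mk] using isTriOp_one (U := U) m
  | succ s ih =>
    rw [pow_succ']
    convert (isTriOp_dx (m - s)).mul ih using 1
    · omega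
    · omega
    · refine Prod.ext ?_ ?_ <;> simp

theorem isTriOp_dy_pow (m s : ℕ) : IsTriOp m (m - s) s (0, -s) (dy U ^ s) := by
  induction s with
  | zero => simpa [← Prod.zero_eq_mk] using isTriOp_one (U := U) m
  | succ s ih =>
    rw [pow_succ']
    convert (isTriOp_dy (m - s)).mul ih using 1
    · omega
    · omega
    · refine Prod.ext ?_ ?_ <;> simp

theorem isTriOp_cx_pow (m s : ℕ) : IsTriOp m (m + s) 0 (s, 0) (mulOp U (cx U) ^ s) := by
  induction s with
  | zero => simpa [← Prod.zero_eq_mk] using isTriOp_one (U := U) m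
  | succ s ih =>
    rw [pow_succ']
    convert (isTriOp_cx (m + s)).mul ih using 1
    · omega
    · refine Prod.ext ?_ ?_ <;> simp
      ring

theorem isTriOp_cy_pow (m s : ℕ) : IsTriOp m (m + s) 0 (0, s) (mulOp U (cy U) ^ s) := by
  induction s with
  | zero => simpa [← Prod.zero_eq_mk] using isTriOp_one (U := U) m
  | succ s ih =>
    rw [pow_succ']
    convert (isTriOp_cy (m + s)).mul ih using 1
    · omega
    · refine Prod.ext ?_ ?_ <;> simp
      ring

/-- Read from the right, the factors remove the degrees `m + l, …, m + 1` in turn. -/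
theorem isTriOp_prod_euler (m l : ℕ) : IsTriOp (m + l) m l 0 ((List.range l).map fun k =>
    mulOp U (cx U) * dx U + mulOp U (cy U) * dy U
      + (-((m + k + 1 : ℕ) : ℂ)) • (1 : Module.End ℂ (Smooth U))).prod := by
  induction l with
  | zero => simpa using isTriOp_one (U := U) m
  | succ l ih =>
    rw [List.range_succ, List.map_append, List.prod_append, List.map_singleton,
      List.prod_singleton, ← add_zero (0 : ℤ × ℤ)]
    exact ih.mul (isTriOp_euler (m + l))

/-- The derivatives lower the degree by `α + β` and the Euler factors by the remaining `Δ - α - β`;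
the total order is `Δ` for every `α, β`, whence the shift for `ε = +`. -/
theorem isTriOp_qBar {n Δ α β : ℕ} (hΔ : Δ ≤ n) (h : α + β ≤ Δ) :
    IsTriOp n (n - Δ) Δ (-α, -β) (qBar U n Δ α β) := by
  have h1 := isTriOp_prod_euler (U := U) (n - Δ) (Δ - α - β)
  have h2 := (isTriOp_dx_pow (U := U) (n - β) α).mul (isTriOp_dy_pow n β)
  rw [show n - Δ + (Δ - α - β) = n - β - α by omega] at h1
  have h3 := h1.mul h2
  rw [← mul_assoc] at h3
  convert h3 using 1
  · omega
  · simp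
  · rw [qBar]
    congr 5
    funext k
    congr 2
    push_cast [Nat.cast_sub hΔ]
    ring

theorem isTriOp_mulOp_mono {m m' α β : ℕ} (h : m + α + β ≤ m') :
    IsTriOp m m' 0 (α, β) (mulOp U (cx U ^ α * cy U ^ β)) := by
  rw [mulOp_mul, mulOp_pow, mulOp_pow]
  convert ((isTriOp_cx_pow (m + β) α).mul (isTriOp_cy_pow m β)).mono
    (show m + β + α ≤ m' by omega) using 1
  simp

/-! ### The matrix entries of the monomials -/

/-- The row of the nonzero entry of the monomials of type `ε`. -/
def Kind.row : Kind → Fin 2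
  | .one => 0
  | .two => 1
  | .plus => 0
  | .minus => 1

/-- The column of the nonzero entry of the monomials of type `ε`. -/
def Kind.col : Kind → Fin 2
  | .one => 0
  | .two => 1
  | .plus => 1
  | .minus => 0

/-- The nonzero entry of the prefactor `X_ε`. -/
def prefactorEntry (U : Opens (ℂ × ℂ)) (n Δ : ℕ) : Kind → ℕ → ℕ → Module.End ℂ (Smooth U)
  | .one, _, _ => 1
  | .two, _, _ => 1
  | .plus, α, β => qBar U n Δ α β
  | .minus, α, β => mulOp U (cx U ^ α * cy U ^ β)

/-- The bidegree of the prefactor `X_ε`. -/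
def prefactorDeg : Kind → ℕ → ℕ → ℤ × ℤ
  | .one, _, _ => 0
  | .two, _, _ => 0
  | .plus, α, β => (-α, -β)
  | .minus, α, β => (α, β)

theorem prefactor_eq (n Δ : ℕ) (ε : Kind) (α β : ℕ) :
    prefactor U n Δ ε α β = Matrix.single ε.row ε.col (prefactorEntry U n Δ ε α β) := by
  cases ε <;> ext1 r c <;> fin_cases r <;> fin_cases c <;> rfl

/-- The nonzero entry of the monomial `T^K_ε`. -/
def monEntry (U : Opens (ℂ × ℂ)) (n Δ : ℕ) (ε : Kind) (m : MonIdx) : Module.End ℂ (Smooth U) :=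
  prefactorEntry U n Δ ε m.α m.β *
    (List.ofFn fun i => genJ U (compDeg n Δ ε.col) i ^ m.K i).prod

/-- The bidegree of the monomial `T^K_ε`. -/
def monDeg (ε : Kind) (m : MonIdx) : ℤ × ℤ :=
  prefactorDeg ε m.α m.β + ∑ i, m.K i • genDeg i

theorem genT_eq (n Δ : ℕ) (i : Fin 8) :
    genT U n Δ i = Matrix.diagonalRingHom (Fin 2) _ fun c => genJ U (compDeg n Δ c) i := by
  ext1 r c
  fin_cases r <;> fin_cases c <;> rfl

theorem single_mul_diagonalRingHom (r c : Fin 2) (E : Module.End ℂ (Smooth U))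
    (v : Fin 2 → Module.End ℂ (Smooth U)) :
    Matrix.single r c E * Matrix.diagonalRingHom (Fin 2) _ v = Matrix.single r c (E * v c) := by
  ext1 a b
  rw [Matrix.diagonalRingHom_apply, Matrix.mul_diagonal, Matrix.single_apply, Matrix.single_apply]
  split_ifs with h
  · rw [h.2]
  · rw [zero_mul]

theorem monOp_eq (n Δ : ℕ) (ε : Kind) (m : MonIdx) :
    monOp U n Δ ε m = Matrix.single ε.row ε.col (monEntry U n Δ ε m) := by
  have h : (List.ofFn fun i : Fin 8 => genT U n Δ i ^ m.K i).prod
      = Matrix.diagonalRingHom (Fin 2) _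
        (List.ofFn fun i : Fin 8 => (fun c => genJ U (compDeg n Δ c) i) ^ m.K i).prod := by
    rw [map_list_prod, List.map_ofFn]
    simp only [genT_eq, map_pow, Function.comp_def]
  rw [monOp, prefactor_eq, h, single_mul_diagonalRingHom, monEntry]
  congr 2

theorem monOp_mul_eq (n Δ : ℕ) (ε : Kind) (m : MonIdx) (i j : ℕ) :
    monOp U n Δ ε m * genT U n Δ 6 ^ i * genT U n Δ 7 ^ j
      = Matrix.single ε.row ε.col (monEntry U n Δ ε m * genJ U (compDeg n Δ ε.col) 6 ^ i
          * genJ U (compDeg n Δ ε.col) 7 ^ j) := by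
  rw [monOp_eq, genT_eq, genT_eq, ← map_pow, ← map_pow, single_mul_diagonalRingHom,
    single_mul_diagonalRingHom]
  rfl

theorem isTriOp_monEntry {n Δ : ℕ} (hΔ : Δ ≤ n) {ε : Kind} {m : MonIdx}
    (hm : m.Admissible Δ ε) :
    IsTriOp (compDeg n Δ ε.col) (compDeg n Δ ε.row) (m.degree + shift Δ ε) (monDeg ε m)
      (monEntry U n Δ ε m) := by
  have h := isTriOp_prod_ofFn fun i => (isTriOp_genJ (U := U) (compDeg n Δ ε.col) i).pow (m.K i)
  simp only [mul_one] at h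
  have h' : IsTriOp (compDeg n Δ ε.col) (compDeg n Δ ε.row) (shift Δ ε)
      (prefactorDeg ε m.α m.β) (prefactorEntry U n Δ ε m.α m.β) := by
    cases ε
    · exact isTriOp_one _
    · exact isTriOp_one _
    · exact isTriOp_qBar hΔ hm
    · refine isTriOp_mulOp_mono ?_
      have : m.α + m.β ≤ Δ := hm
      change n - Δ + m.α + m.β ≤ n
      omega
  rw [add_comm]
  exact h'.mul h

/-! ### Short monomials of each bidegree -/

/-- The bidegrees of `J¹, …, J⁶` are the six unit steps of a hexagonal lattice. For mixed signs the
diagonal steps of `J³` or `J⁶` change both coordinates at once. -/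
theorem exists_exponents (a b : ℤ) : ∃ K : Fin 8 → ℕ, ∑ i, K i • genDeg i = (a, b) ∧
    ∑ i, K i ≤ (a + b).toNat + (-a).toNat + (-b).toNat := by
  have key : ∃ k₀ k₁ k₂ k₃ k₄ k₅ : ℕ, (k₀ : ℤ) - k₂ - k₃ + k₅ = a ∧ (k₁ : ℤ) + k₂ - k₄ - k₅ = b ∧
      k₀ + k₁ + k₂ + k₃ + k₄ + k₅ ≤ (a + b).toNat + (-a).toNat + (-b).toNat := by
    by_cases ha : 0 ≤ a <;> by_cases hb : 0 ≤ b
    · exact ⟨a.toNat, b.toNat, 0, 0, 0, 0, by omega, by omega, by omega⟩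
    · exact ⟨(a + b).toNat, 0, 0, 0, (-(a + b)).toNat, min a.toNat (-b).toNat,
        by omega, by omega, by omega⟩
    · exact ⟨0, (a + b).toNat, min b.toNat (-a).toNat, (-(a + b)).toNat, 0, 0,
        by omega, by omega, by omega⟩
    · exact ⟨0, 0, 0, (-a).toNat, (-b).toNat, 0, by omega, by omega, by omega⟩
  obtain ⟨k₀, k₁, k₂, k₃, k₄, k₅, h1, h2, h3⟩ := key
  refine ⟨![k₀, k₁, k₂, k₃, k₄, k₅, 0, 0], ?_, ?_⟩
  · ext
    · simp [Fin.sum_univ_eight, genDeg]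
      omega
    · simp [Fin.sum_univ_eight, genDeg]
      omega
  · simp [Fin.sum_univ_eight]
    omega

/-- The prefactor absorbs as much of `d` as its budget `Δ` permits, and the generators supply the
rest by a short path. -/
theorem exists_short_monomial {n Δ : ℕ} (hΔ : Δ ≤ n) (ε : Kind) (d : ℤ × ℤ) :
    ∃ m : MonIdx, m.Admissible Δ ε ∧ monDeg ε m = d ∧
      m.degree + shift Δ ε ≤ numLines (compDeg n Δ ε.col) (compDeg n Δ ε.row) d := by
  obtain ⟨a, b⟩ := d
  have key : ∀ α β : ℕ, ∃ m : MonIdx, m.α = α ∧ m.β = β ∧ monDeg ε m = (a, b) ∧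
      m.degree ≤ (a - (prefactorDeg ε α β).1 + (b - (prefactorDeg ε α β).2)).toNat
        + (-(a - (prefactorDeg ε α β).1)).toNat + (-(b - (prefactorDeg ε α β).2)).toNat := by
    intro α β
    obtain ⟨K, h1, h2⟩ :=
      exists_exponents (a - (prefactorDeg ε α β).1) (b - (prefactorDeg ε α β).2)
    refine ⟨⟨α, β, K⟩, rfl, rfl, ?_, h2⟩
    rw [monDeg, h1]
    ext <;> simp
  cases ε
  · obtain ⟨m, h1, h2, h3, h4⟩ := key 0 0
    refine ⟨m, ⟨h1, h2⟩, h3, ?_⟩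
    simp only [prefactorDeg, numLines, shift, Kind.row, Kind.col, Prod.fst_zero, Prod.snd_zero]
      at h4 ⊢
    omega
  · obtain ⟨m, h1, h2, h3, h4⟩ := key 0 0
    refine ⟨m, ⟨h1, h2⟩, h3, ?_⟩
    simp only [prefactorDeg, numLines, shift, Kind.row, Kind.col, Prod.fst_zero, Prod.snd_zero]
      at h4 ⊢
    omega
  · obtain ⟨m, h1, h2, h3, h4⟩ :=
      -- `Q⁺` lowers exponents, so it takes up the negative parts of `a` and then `b`.
      key (min (-a).toNat Δ) (min (-b).toNat (Δ - min (-a).toNat Δ))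
    refine ⟨m, ?_, h3, ?_⟩
    · change m.α + m.β ≤ Δ
      omega
    · simp only [prefactorDeg, numLines, shift, Kind.row, Kind.col, compDeg, Matrix.cons_val_zero,
        Matrix.cons_val_one] at h4 ⊢
      omega
  -- `Q⁻` raises exponents, so it takes up the positive parts.
  · obtain ⟨m, h1, h2, h3, h4⟩ := key (min a.toNat Δ) (min b.toNat (Δ - min a.toNat Δ))
    refine ⟨m, ?_, h3, ?_⟩
    · change m.α + m.β ≤ Δ
      omega
    · simp only [prefactorDeg, numLines, shift, Kind.row, Kind.col, compDeg, Matrix.cons_val_zero,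
        Matrix.cons_val_one] at h4 ⊢
      omega

/-! ### Representative systems -/

theorem hasBidegree_monOp {n Δ : ℕ} (hΔ : Δ ≤ n) {ε : Kind} {m : MonIdx}
    (hm : m.Admissible Δ ε) : HasBidegree (monOp U n Δ ε m) (monDeg ε m) := by
  obtain ⟨_, _, p, _, hp, _⟩ := isTriOp_monEntry (U := U) hΔ hm
  intro r c i j
  rw [monOp_eq, Matrix.single_apply]
  split_ifs
  · exact hp.apply_mem_monomialLine i j
  · exact zero_mem _

theorem eq_monDeg_of_hasBidegree [Nonempty U] {n Δ : ℕ} (hΔ : Δ ≤ n) {ε : Kind} {m : MonIdx}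
    (hm : m.Admissible Δ ε) {d : ℤ × ℤ} (hd : HasBidegree (monOp U n Δ ε m) d) :
    d = monDeg ε m := by
  obtain ⟨_, _, p, _, hp, N, hN⟩ := isTriOp_monEntry (U := U) hΔ hm
  have h := hd ε.row ε.col N N
  rw [monOp_eq, Matrix.single_apply, if_pos ⟨rfl, rfl⟩] at h
  exact hp.bidegree_unique (hN N N le_rfl le_rfl) h

/-- A symbol that does not vanish for large exponents fixes the bidegree of its operator. -/
theorem sameBidegree_iff [Nonempty U] {n Δ : ℕ} (hΔ : Δ ≤ n) {ε : Kind} {m m' : MonIdx}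
    (hm : m.Admissible Δ ε) (hm' : m'.Admissible Δ ε) :
    SameBidegree U n Δ ε m m' ↔ monDeg ε m = monDeg ε m' := by
  constructor
  · rintro ⟨d, hd, hd'⟩
    rw [← eq_monDeg_of_hasBidegree hΔ hm hd, eq_monDeg_of_hasBidegree hΔ hm' hd']
  · intro h
    exact ⟨_, hasBidegree_monOp hΔ hm, h ▸ hasBidegree_monOp hΔ hm'⟩

/-- Maximal length means least degree within a bidegree: the length of `T^K_ε` is a minimum over its
bidegree, and equality with `|K|` says that nothing there is shorter. So a representative is no
longer than the explicit short monomial. -/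
theorem exists_short_mem [Nonempty U] {n Δ : ℕ} (hΔ : Δ ≤ n) {ε : Kind} {S : Set MonIdx}
    (hS : IsRepresentativeSystem U n Δ ε S) (d : ℤ × ℤ) :
    ∃ m ∈ S, m.Admissible Δ ε ∧ monDeg ε m = d ∧
      m.degree + shift Δ ε ≤ numLines (compDeg n Δ ε.col) (compDeg n Δ ε.row) d := by
  obtain ⟨m₁, h₁, hd₁, hl₁⟩ := exists_short_monomial hΔ ε d
  let A : Set MonIdx := {m | m.Admissible Δ ε ∧ monDeg ε m = d}
  have hA : A.Nonempty := ⟨m₁, h₁, hd₁⟩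
  let m₀ := Function.argminOn MonIdx.degree A hA
  have hm₀ : m₀ ∈ A := Function.argminOn_mem _ _ _
  have hmin : ∀ m ∈ A, m₀.degree ≤ m.degree := fun m hm => Function.argminOn_le _ _ hm
  have hmax : IsMaximalLength U n Δ ε m₀ := by
    refine ⟨hm₀.1, le_antisymm (Nat.sInf_le ?_) (le_csInf ?_ ?_)⟩
    · exact ⟨m₀, hm₀.1, (sameBidegree_iff hΔ hm₀.1 hm₀.1).2 rfl, le_rfl, rfl⟩
    · exact ⟨_, m₀, hm₀.1, (sameBidegree_iff hΔ hm₀.1 hm₀.1).2 rfl, le_rfl, rfl⟩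
    · rintro _ ⟨m, hm, hs, -, rfl⟩
      exact hmin m ⟨hm, ((sameBidegree_iff hΔ hm hm₀.1).1 hs).trans hm₀.2⟩
  obtain ⟨m, ⟨hmS, hs⟩, -⟩ := hS.2 m₀ hmax
  obtain ⟨hm, hlen⟩ := hS.1 m hmS
  have hd := ((sameBidegree_iff hΔ hm hm₀.1).1 hs).trans hm₀.2
  refine ⟨m, hmS, hm, hd, ?_⟩
  have hle : m.degree ≤ m₀.degree := by
    by_contra hlt
    have : monLength U n Δ ε m ≤ m₀.degree := Nat.sInf_le
      ⟨m₀, hm₀.1, (sameBidegree_iff hΔ hm₀.1 hm).2 (hm₀.2.trans hd.symm), by omega, rfl⟩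
    omega
  have := hmin m₁ ⟨h₁, hd₁⟩
  omega

/-! ### The spanning theorem -/

/-- Converse of `ActsBy.mapsTri`, by independence of the monomials. -/
theorem ActsBy.symbol_map [Nonempty U] {E : Module.End ℂ (Smooth U)} {d : ℤ × ℤ}
    {p : ℂ × ℂ → ℂ} {m m' : ℕ} (h : ActsBy E d p) (hE : MapsTri m m' E) (i j : ℕ)
    (hij : i + j ≤ m) (h0 : p (i, j) ≠ 0) : i + j + d.1 + d.2 ≤ m' := by
  by_contra hgt
  obtain ⟨φ, hφ⟩ := exists_coeff (U := U)
  have h1 := (h i j).1 h0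
  have h2 := coeff_triModule hφ (hE _ (mono_mem_triModule hij))
    (a := (i + d.1).toNat) (b := (j + d.2).toNat) (by omega)
  rw [(h i j).2, map_smul, hφ] at h2
  simp [h0] at h2

/-- Right factors of bidegree zero cause no shift, so the symbols just multiply. -/
theorem ActsBy.mul_genJ {E : Module.End ℂ (Smooth U)} {d : ℤ × ℤ} {p : ℂ × ℂ → ℂ}
    (h : ActsBy E d p) (m s t : ℕ) :
    ActsBy (E * genJ U m 6 ^ s * genJ U m 7 ^ t) d
      (p * fun z => (z.1 - (m : ℂ) / 3) ^ s * (z.2 - (m : ℂ) / 3) ^ t) := by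
  have hs : ∀ q : ℂ × ℂ → ℂ, shiftFun 0 q = q := fun q => by ext; simp [shiftFun]
  have key : ∀ {E J : Module.End ℂ (Smooth U)} {p q : ℂ × ℂ → ℂ}, ActsBy E d p → ActsBy J 0 q →
      ∀ s : ℕ, ActsBy (E * J ^ s) d (p * q ^ s) := by
    intro E J p q hE hJ s
    induction s with
    | zero => simpa using hE
    | succ s ih =>
      have h1 := ih.mul hJ
      rwa [hs, add_zero, mul_assoc, mul_assoc, ← pow_succ, ← pow_succ] at h1
  have h1 := key (key h (actsBy_genJ_six m) s) (actsBy_genJ_seven m) t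
  rwa [mul_assoc p] at h1

theorem ActsBy.eq_of_symbol_eq {k : ℕ} {E E' : Module.End ℂ (Smooth U)} {d : ℤ × ℤ}
    {p : ℂ × ℂ → ℂ} (hE : E ∈ ordSub U k) (hE' : E' ∈ ordSub U k) (h : ActsBy E d p)
    (h' : ActsBy E' d p) : E = E' := by
  have h0 : E + (-1 : ℂ) • E' = 0 := by
    refine eq_zero_of_apply_mono (add_mem hE (Submodule.smul_mem _ (-1 : ℂ) hE')) fun i j => ?_
    have := ((h.add (h'.smul (-1))) i j).2
    rw [this]
    simp
  ext1 f
  have h1 := LinearMap.congr_fun h0 f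
  rw [LinearMap.add_apply, LinearMap.smul_apply, LinearMap.zero_apply, neg_one_smul] at h1
  exact add_neg_eq_zero.1 h1

theorem entry_mem_span [Nonempty U] {n Δ k l : ℕ} (hΔ : Δ ≤ n)
    {S : Kind → Set MonIdx} (hS : ∀ ε, IsRepresentativeSystem U n Δ ε (S ε)) (ε : Kind)
    {T : Module.End ℂ (Smooth U)} (hlk : l ≤ k) (hl : l ≤ compDeg n Δ ε.col)
    (hT : T ∈ ordSub U l) (hmap : MapsTri (compDeg n Δ ε.col) (compDeg n Δ ε.row) T) :
    Matrix.single ε.row ε.col T ∈ Submodule.span ℂ (spanningMonomials U n Δ k S) := by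
  let Φ : Module.End ℂ (Smooth U) →ₗ[ℂ] MatOp U := Matrix.singleLinearMap ℂ ε.row ε.col
  change T ∈ (Submodule.span ℂ (spanningMonomials U n Δ k S)).comap Φ
  obtain ⟨F, E, rfl, hE⟩ := exists_homogeneous_decomposition hl hT hmap
  refine Submodule.sum_mem _ fun d hd => ?_
  obtain ⟨hEl, p, hp, hact, hmp⟩ := hE d hd
  by_cases hne : p = 0
  · subst hne
    rw [hact.eq_of_symbol_eq hEl (zero_mem _) (actsBy_zero d)]
    exact zero_mem _
  obtain ⟨m, hmS, hm, rfl, hlen⟩ := exists_short_mem hΔ (hS ε) d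
  obtain ⟨h1, h2, p₀, hp₀, h3, N, hN⟩ := isTriOp_monEntry (U := U) hΔ hm
  obtain ⟨e, he, r, hr, rfl⟩ := exists_eq_mul_of_minimal hl hp (fun i j => (hact i j).1) hmp hlen
    hp₀ (fun h0 => hN N N le_rfl le_rfl (by rw [h0]; rfl)) (fun i j => (h3 i j).1)
    (h3.symbol_map h2) hne
  have key : ∃ G ∈ (Submodule.span ℂ (spanningMonomials U n Δ k S)).comap Φ,
      G ∈ ordSub U l ∧ ActsBy G (monDeg ε m) (p₀ * r) := by
    -- Centring at `m/3`, with `m` the degree of the column, makes the basis polynomials the symbols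
    -- of the powers of `J⁷` and `J⁸`.
    have hr' := affineFun_pow_le_span ((compDeg n Δ ε.col : ℂ) / 3) ((compDeg n Δ ε.col : ℂ) / 3)
      e hr
    clear hr hne hp hact hmp
    induction hr' using Submodule.span_induction with
    | mem r hr =>
      obtain ⟨s, t, hst, rfl⟩ := hr
      refine ⟨monEntry U n Δ ε m * genJ U (compDeg n Δ ε.col) 6 ^ s
        * genJ U (compDeg n Δ ε.col) 7 ^ t, ?_, ?_, h3.mul_genJ _ s t⟩
      · refine Submodule.subset_span ⟨ε, m, s, t, hmS, by omega, ?_⟩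
        rw [monOp_mul_eq]
        rfl
      · have h6 := ((isTriOp_genJ (U := U) (compDeg n Δ ε.col) 6).pow s).1
        have h7 := ((isTriOp_genJ (U := U) (compDeg n Δ ε.col) 7).pow t).1
        exact ordSub_mono (by omega) (mul_mem_ordSub (mul_mem_ordSub h1 h6) h7)
    | zero => exact ⟨0, zero_mem _, zero_mem _, by rw [mul_zero]; exact actsBy_zero _⟩
    | add r r' _ _ hr hr' =>
      obtain ⟨G, hG1, hG2, hG3⟩ := hr
      obtain ⟨G', hG1', hG2', hG3'⟩ := hr'
      exact ⟨G + G', add_mem hG1 hG1', add_mem hG2 hG2', by rw [mul_add]; exact hG3.add hG3'⟩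
    | smul c r _ hr =>
      obtain ⟨G, hG1, hG2, hG3⟩ := hr
      exact ⟨c • G, Submodule.smul_mem _ _ hG1, Submodule.smul_mem _ _ hG2,
        by rw [mul_smul_comm]; exact hG3.smul c⟩
  obtain ⟨G, hG, hGl, hGact⟩ := key
  rwa [hact.eq_of_symbol_eq hEl hGl hGact]

/-- A vector with a single nonzero component isolates one entry. -/
theorem PreservesModule.mapsTri {n Δ : ℕ} {T : MatOp U} (h : PreservesModule U n Δ T)
    (r c : Fin 2) : MapsTri (compDeg n Δ c) (compDeg n Δ r) (T r c) := by
  intro f hf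
  have h1 := h (Pi.single c f) (fun c' => ?_) r
  · simp only [act] at h1
    rw [Finset.sum_eq_single c] at h1
    · rwa [Pi.single_eq_same] at h1
    · intro c' _ hc'
      rw [Pi.single_eq_of_ne hc', map_zero]
    · simp
  · by_cases hc : c' = c
    · subst hc
      rwa [Pi.single_eq_same]
    · rw [Pi.single_eq_of_ne hc]
      exact zero_mem _

end TriangularQES

end

/-! ### Assembling the four matrix entries -/

theorem mainTheorem7 (U : TopologicalSpace.Opens (ℂ × ℂ)) (n Δ k : ℕ) (hΔ : Δ ≤ n)
    (S : TriangularQES.Kind → Set TriangularQES.MonIdx)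
    (hS : ∀ ε, TriangularQES.IsRepresentativeSystem U n Δ ε (S ε))
    (T : TriangularQES.MatOp U)
    (hT : TriangularQES.InDistinguishedComplement U n Δ T)
    (hk : TriangularQES.MatHasOrderLE U k T) :
    T ∈ Submodule.span ℂ (TriangularQES.spanningMonomials U n Δ k S) := by
  open TriangularQES in
  rcases isEmpty_or_nonempty U with hU | hU
  -- Over the empty set the monomials are not independent, but every operator is zero.
  · have h0 : T = 0 := by
      ext r c f z
      exact hU.elim z
    rw [h0]
    exact zero_mem _
  have key : ∀ ε : Kind, Matrix.single ε.row ε.col (T ε.row ε.col) ∈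
      Submodule.span ℂ (spanningMonomials U n Δ k S) := by
    intro ε
    have hmap := hT.1.mapsTri ε.row ε.col
    -- The order used is the smaller of `k` and the column degree; if `k` is larger, the bound comes
    -- from the distinguished complement.
    rcases le_total k (compDeg n Δ ε.col) with h | h
    · exact entry_mem_span hΔ hS ε le_rfl h (hk _ _) hmap
    · exact entry_mem_span hΔ hS ε h le_rfl (hT.2 _ _) hmap
  have e : T = Matrix.single 0 0 (T 0 0) + Matrix.single 0 1 (T 0 1)
      + (Matrix.single 1 0 (T 1 0) + Matrix.single 1 1 (T 1 1)) := by
    ext1 r c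
    fin_cases r <;> fin_cases c <;> simp
  rw [e]
  exact add_mem (add_mem (key .one) (key .plus)) (add_mem (key .minus) (key .two))
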